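/- For a finite group $G$ let $\rho(G)=\prod_{g\in G}o(g)$ be the product of the orders of its elements, and let $\operatorname{Exp}_\rho(G)=\{\alpha_1,\dots,\alpha_k\}$ be the set (without multiplicities) of exponents in the prime factorization $\rho(G)=p_1^{\alpha_1}\cdots p_k^{\alpha_k}$, where $p_1,\dots,p_k$ are the distinct prime divisors of $\rho(G)$. Write $\mathbb{Z}_n$ for the cyclic group of order $n$. **Theorem.** Let $G$ be a finite group and let $q$ and $r$ be distinct odd prime numbers. Then $$\operatorname{Exp}_\rho(\mathbb{Z}_{2qr})=\{qr,\;2r(q-1),\;2q(r-1)\},$$ and $\operatorname{Exp}_\rho(G)=\operatorname{Exp}_\rho(\mathbb{Z}_{2qr})$ if and only if $G\cong\mathbb{Z}_{2qr}$, or $\{q,r\}=\{3,5\}$ and $G\cong\mathrm{PSL}(2,5)$. -/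

import Mathlib

/-- The product of the element orders of a finite group `G`. -/
noncomputable def rho (G : Type*) [Group G] : ℕ := ∏ᶠ g : G, orderOf g

/-- The set of exponents in the prime factorization of `n`. -/
def expSet (n : ℕ) : Finset ℕ := n.primeFactors.image n.factorization

/-- The set of exponents in the prime factorization of the product of the element orders of `G`. -/
noncomputable def expRho (G : Type*) [Group G] : Finset ℕ := expSet (rho G)

/-! The engine is a divisibility: the exponent of `p` in `rho G` is a multiple of m, the `p'`-part
of |G| (`ordCompl_dvd_factorization_rho`). Grouping elements by the conjugacy class of their
`p`-part reduces this to Frobenius' count of `p`-regular elements (`ordCompl_dvd_cardRegular`). If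
the exponent equals m, only one class contributes, so all nontrivial `p`-elements are conjugate of
order p (`isConj_of_factorization_rho_eq`).

Exponents at odd primes are even, as g and g⁻¹ pair off. Hence the odd number qr is the exponent of
2, |G| = 2^(a+1)qr, and all nontrivial 2-elements are conjugate involutions. For a Sylow subgroup P
of prime order, the exponent determines |N(P) : C(P)| (`factorization_rho_mul_card_normalizer`);
here it is 2^a for both q and r. This quotient is a cyclic 2-group induced by involutions, so a ≤ 1.

If a = 0, Burnside transfer makes G abelian, hence cyclic. If a = 1, fusion of involutions in a
Sylow subgroup of order 4 forces 3 ∣ qr, Sylow counting gives |G| = 60, and G acts faithfully on its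
five Sylow 2-subgroups, so G ≅ A₅. Running this classification on PSL(2,5), whose exponents are
computed directly, identifies it with A₅. -/

/-- An exponent congruent to `1` modulo the `p`-part of `n` and to `0` modulo the `p'`-part. -/
noncomputable def pPartExponent (p n : ℕ) : ℕ :=
  if h : (p ^ n.factorization p).Coprime (n / p ^ n.factorization p) then
    Nat.chineseRemainder h 1 0
  else 0

lemma pPartExponent_spec {p n : ℕ} (hp : p.Prime) (hn : n ≠ 0) :
    pPartExponent p n ≡ 1 [MOD p ^ n.factorization p] ∧
      n / p ^ n.factorization p ∣ pPartExponent p n := by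
  have h : (p ^ n.factorization p).Coprime (n / p ^ n.factorization p) :=
    (Nat.coprime_ordCompl hp hn).pow_left _
  rw [pPartExponent, dif_pos h]
  exact ⟨(Nat.chineseRemainder h 1 0).2.1,
    (Nat.modEq_zero_iff_dvd).1 (Nat.chineseRemainder h 1 0).2.2⟩

/-- The number of `p`-regular elements of a group. -/
noncomputable def cardRegular (p : ℕ) (G : Type*) [Group G] : ℕ :=
  Nat.card {z : G // ¬ p ∣ orderOf z}

/-! ### The `p`-part of an element and `p`-regular elements -/

section PPart

variable {G : Type*} [Group G] {p : ℕ}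

/-- The modulus n need only be a multiple of the order of x, so the exponent computed from |G| also
serves in quotients of G. -/
lemma pow_pPartExponent_eq_one_iff {n : ℕ} (hp : p.Prime) (hn : n ≠ 0) {x : G}
    (hx : orderOf x ∣ n) : x ^ pPartExponent p n = 1 ↔ ¬ p ∣ orderOf x := by
  obtain ⟨h1, h2⟩ := pPartExponent_spec hp hn
  rw [← orderOf_dvd_iff_pow_eq_one]
  refine ⟨fun h hd => ?_, fun h => ?_⟩
  · have hk : p ∣ pPartExponent p n := hd.trans h
    have hpn : p ∣ p ^ n.factorization p :=
      dvd_pow_self p (hp.factorization_pos_of_dvd hn (hd.trans hx)).ne'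
    have h3 : 0 ≡ 1 [MOD p] := ((Nat.modEq_zero_iff_dvd.2 hk).symm).trans (h1.of_dvd hpn)
    exact hp.one_lt.ne' (Nat.dvd_one.1 (Nat.modEq_zero_iff_dvd.1 h3.symm))
  · refine dvd_trans ?_ h2
    refine Nat.Coprime.dvd_of_dvd_mul_left (m := p ^ n.factorization p) ?_ ?_
    · exact ((hp.coprime_iff_not_dvd.2 h).pow_left _).symm
    · rwa [Nat.ordProj_mul_ordCompl_eq_self]

lemma pow_pPartExponent_of_pow_eq_one {n : ℕ} (hp : p.Prime) (hn : n ≠ 0) {x : G}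
    (hx : x ^ p ^ n.factorization p = 1) : x ^ pPartExponent p n = x := by
  have h := (pPartExponent_spec hp hn).1.of_dvd (orderOf_dvd_of_pow_eq_one hx)
  simpa using pow_eq_pow_iff_modEq.2 h

variable (p) in
/-- The `p`-part of an element of a finite group. -/
noncomputable def pPart (g : G) : G := g ^ pPartExponent p (Nat.card G)

variable [Finite G]

lemma pPart_eq_one_iff (hp : p.Prime) {g : G} : pPart p g = 1 ↔ ¬ p ∣ orderOf g :=
  pow_pPartExponent_eq_one_iff hp Nat.card_pos.ne' (orderOf_dvd_natCard g)

lemma pPart_pow (hp : p.Prime) (g : G) :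
    pPart p g ^ p ^ (Nat.card G).factorization p = 1 := by
  obtain ⟨c, hc⟩ := (pPartExponent_spec hp (Nat.card_pos (α := G)).ne').2
  rw [pPart, ← pow_mul, hc, mul_right_comm, mul_comm (Nat.card G / _),
    Nat.ordProj_mul_ordCompl_eq_self, pow_mul, pow_card_eq_one', one_pow]

lemma pPart_of_pow_eq_one (hp : p.Prime) {g : G}
    (hg : g ^ p ^ (Nat.card G).factorization p = 1) : pPart p g = g :=
  pow_pPartExponent_of_pow_eq_one hp Nat.card_pos.ne' hg

omit [Finite G] in
lemma pPart_mul {g h : G} (hgh : Commute g h) : pPart p (g * h) = pPart p g * pPart p h :=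
  hgh.mul_pow _

omit [Finite G] in
lemma pPart_inv (g : G) : pPart p g⁻¹ = (pPart p g)⁻¹ := inv_pow _ _

omit [Finite G] in
lemma commute_pPart (g : G) : Commute (pPart p g) g := (Commute.refl g).pow_left _

omit [Finite G] in
lemma pPart_conj (c g : G) : pPart p (c * g * c⁻¹) = c * pPart p g * c⁻¹ := conj_pow

lemma pPart_pPart (hp : p.Prime) (g : G) : pPart p (pPart p g) = pPart p g :=
  pPart_of_pow_eq_one hp (pPart_pow hp g)

lemma not_dvd_orderOf_pPart_inv_mul (hp : p.Prime) (g : G) :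
    ¬ p ∣ orderOf ((pPart p g)⁻¹ * g) := by
  rw [← pPart_eq_one_iff hp, pPart_mul (commute_pPart g).inv_left, pPart_inv, pPart_pPart hp,
    inv_mul_cancel]

/-- The elements with `p`-part `y` are the products of `y` with a `p`-regular element centralizing
it. -/
lemma card_pPart_eq (hp : p.Prime) {y : G} (hy : pPart p y = y) :
    Nat.card {g : G // pPart p g = y} =
      cardRegular p (Subgroup.centralizer ({y} : Set G)) := by
  refine Nat.card_congr ⟨fun g => ⟨⟨y⁻¹ * g.1, ?_⟩, ?_⟩, fun z => ⟨y * z.1.1, ?_⟩, ?_, ?_⟩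
  · rw [Subgroup.mem_centralizer_singleton_iff]
    have h : Commute y g.1 := by
      have := commute_pPart (p := p) g.1
      rwa [g.2] at this
    exact (((Commute.refl y).inv_left.mul_left h.symm)).eq
  · rw [Subgroup.orderOf_mk]
    have := not_dvd_orderOf_pPart_inv_mul hp g.1
    rwa [g.2] at this
  · have hz : Commute y z.1.1 := (Subgroup.mem_centralizer_singleton_iff.1 z.1.2).symm
    have h2 := z.2
    rw [← Subgroup.orderOf_coe, ← pPart_eq_one_iff hp] at h2
    rw [pPart_mul hz, hy, h2, mul_one]
  · intro g; simp
  · intro z; simp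

omit [Finite G] in
lemma card_conj_mul_card_centralizer (y : G) :
    Nat.card {x : G // IsConj y x} * Nat.card (Subgroup.centralizer ({y} : Set G)) =
      Nat.card G := by
  have := Subgroup.card_mul_index (MulAction.stabilizer (ConjAct G) y)
  rw [MulAction.index_stabilizer, ← Subgroup.nat_card_centralizer_nat_card_stabilizer, mul_comm]
    at this
  rw [← Nat.card_congr (ConjAct.ofConjAct (G := G)).toEquiv, ← this]
  congr 1
  rw [ConjAct.orbit_eq_carrier_conjClasses]
  refine Nat.card_congr (Equiv.subtypeEquivRight fun x => ?_)
  rw [ConjClasses.mem_carrier_iff_mk_eq, ConjClasses.mk_eq_mk_iff_isConj]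
  exact isConj_comm

/-- Conjugation carries the fibre of `pPart` over y to the fibre over any conjugate, so all these
fibres have the size found in `card_pPart_eq`. -/
lemma card_isConj_pPart (hp : p.Prime) {y : G} (hy : pPart p y = y) :
    Nat.card {g : G // IsConj y (pPart p g)} =
      Nat.card {x : G // IsConj y x} * cardRegular p (Subgroup.centralizer ({y} : Set G)) := by
  have := Fintype.ofFinite {x : G // IsConj y x}
  let f : {g : G // IsConj y (pPart p g)} → {x : G // IsConj y x} := fun g => ⟨_, g.2⟩
  rw [← Nat.card_congr (Equiv.sigmaFiberEquiv f), Nat.card_sigma, Nat.card_eq_fintype_card]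
  rw [Finset.sum_const_nat (m := cardRegular p (Subgroup.centralizer ({y} : Set G)))]
  · rfl
  · rintro ⟨x, hx⟩ -
    rw [← card_pPart_eq hp hy]
    obtain ⟨c, rfl⟩ := isConj_iff.1 hx
    refine Nat.card_congr ⟨fun g => ⟨c⁻¹ * g.1.1 * c, ?_⟩,
      fun g => ⟨⟨c * g.1 * c⁻¹, ?_⟩, ?_⟩, ?_, ?_⟩
    · have h : pPart p g.1.1 = _ := congrArg Subtype.val g.2
      have := pPart_conj (p := p) c⁻¹ g.1.1
      rw [inv_inv] at this
      rw [this, h]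
      group
    · rw [pPart_conj, g.2]; exact hx
    · simp [f, pPart_conj, g.2]
    · intro g; ext; simp [mul_assoc]
    · intro g; ext; simp [mul_assoc]

omit [Finite G] in
lemma eq_one_of_isPGroup_of_not_dvd (hp : p.Prime) {Z : Subgroup G} (hZ : IsPGroup p Z) {c : G} (hc : c ∈ Z)
    (h : ¬ p ∣ orderOf c) : c = 1 := by
  obtain ⟨j, hj⟩ := hZ ⟨c, hc⟩
  have hj' : c ^ p ^ j = 1 := congrArg Subtype.val hj
  obtain ⟨i, -, hi⟩ := (Nat.dvd_prime_pow hp).1 (orderOf_dvd_of_pow_eq_one hj')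
  rcases i.eq_zero_or_pos with rfl | hi0
  · exact orderOf_eq_one_iff.1 (by simpa using hi)
  · exact absurd (hi ▸ dvd_pow_self p hi0.ne') h

/-- The quotient map is a bijection on `p`-regular elements. Two of them in one coset differ by a
`p`-regular element of the `p`-group Z, hence coincide. A preimage of a `p`-regular element becomes
`p`-regular after removing its `p`-part, which the quotient kills. -/
lemma cardRegular_quotient (hp : p.Prime) (Z : Subgroup G) [Z.Normal]
    (hZ : IsPGroup p Z) (hc : Z ≤ Subgroup.center G) :
    cardRegular p (G ⧸ Z) = cardRegular p G := by
  symm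
  refine Nat.card_congr (Equiv.ofBijective (fun z => ⟨QuotientGroup.mk z.1, fun h => z.2 ?_⟩)
    ⟨?_, ?_⟩)
  · exact h.trans (orderOf_map_dvd (QuotientGroup.mk' Z) z.1)
  · rintro ⟨z, hz⟩ ⟨w, hw⟩ h
    have hzw : z⁻¹ * w ∈ Z := QuotientGroup.eq.1 (congrArg Subtype.val h)
    have hcomm : Commute z⁻¹ w := by
      have h1 := Subgroup.mem_center_iff.1 (hc hzw) z
      have h2 : w = z⁻¹ * w * z := by rw [← h1]; group
      rw [Commute.inv_left_iff]
      change z * w = w * z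
      nth_rw 1 [h2]
      group
    have : z⁻¹ * w = 1 := by
      refine eq_one_of_isPGroup_of_not_dvd hp hZ hzw fun hd => ?_
      have := hd.trans hcomm.orderOf_mul_dvd_mul_orderOf
      rw [orderOf_inv] at this
      exact (hp.dvd_mul.1 this).elim hz hw
    exact Subtype.ext (inv_mul_eq_one.1 this)
  · rintro ⟨x, hx⟩
    obtain ⟨h, rfl⟩ := QuotientGroup.mk_surjective x
    refine ⟨⟨_, not_dvd_orderOf_pPart_inv_mul hp h⟩, Subtype.ext ?_⟩
    have h1 : ((pPart p h : G) : G ⧸ Z) = 1 := by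
      rw [pPart, QuotientGroup.mk_pow]
      exact (pow_pPartExponent_eq_one_iff hp Nat.card_pos.ne'
        ((orderOf_map_dvd (QuotientGroup.mk' Z) h).trans (orderOf_dvd_natCard h))).2 hx
    change (((pPart p h)⁻¹ * h : G) : G ⧸ Z) = h
    rw [QuotientGroup.mk_mul, QuotientGroup.mk_inv, h1, inv_one, one_mul]

end PPart

/-! ### Frobenius' divisibility for `p`-regular elements -/

section Frobenius

lemma isPGroup_zpowers {G : Type*} [Group G] {p : ℕ} {y : G} {i : ℕ} (hy : y ^ p ^ i = 1) :
    IsPGroup p (Subgroup.zpowers y) := by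
  rintro ⟨_, k, rfl⟩
  refine ⟨i, Subtype.ext ?_⟩
  change (y ^ k) ^ p ^ i = 1
  rw [← zpow_natCast, zpow_comm, zpow_natCast, hy, one_zpow]

/-- Passing from the centralizer of a `p`-element `y` to its quotient by `⟨y⟩`. -/
lemma exists_quotient_cardRegular_centralizer {G : Type*} [Group G] [Finite G] {p : ℕ}
    (hp : p.Prime) {y : G} (hy : pPart p y = y) :
    ∃ (Z : Subgroup (Subgroup.centralizer ({y} : Set G))) (_ : Z.Normal),
      Nat.card Z = orderOf y ∧ cardRegular p (Subgroup.centralizer ({y} : Set G) ⧸ Z) =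
        cardRegular p (Subgroup.centralizer ({y} : Set G)) := by
  set C := Subgroup.centralizer ({y} : Set G)
  have hyC : y ∈ C := by simp [C, Subgroup.mem_centralizer_singleton_iff]
  have hc : Subgroup.zpowers (⟨y, hyC⟩ : C) ≤ Subgroup.center C := by
    rw [Subgroup.zpowers_le, Subgroup.mem_center_iff]
    rintro ⟨g, hg⟩
    exact Subtype.ext (Subgroup.mem_centralizer_singleton_iff.1 hg)
  have hn : (Subgroup.zpowers (⟨y, hyC⟩ : C)).Normal :=
    ⟨fun n hn g => by rwa [Subgroup.mem_center_iff.1 (hc hn) g, mul_inv_cancel_right]⟩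
  refine ⟨Subgroup.zpowers ⟨y, hyC⟩, hn, by rw [Nat.card_zpowers, Subgroup.orderOf_mk], ?_⟩
  refine cardRegular_quotient hp _ (isPGroup_zpowers (i := (Nat.card G).factorization p) ?_) hc
  have := pPart_pow hp y
  rw [hy] at this
  exact Subtype.ext this

lemma orderOf_eq_prime_pow_of_pPart_eq {G : Type*} [Group G] [Finite G] {p : ℕ}
    (hp : p.Prime) {y : G} (hy : pPart p y = y) : ∃ i, orderOf y = p ^ i := by
  have := pPart_pow hp y
  rw [hy] at this
  obtain ⟨i, -, h⟩ := (Nat.dvd_prime_pow hp).1 (orderOf_dvd_of_pow_eq_one this)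
  exact ⟨i, h⟩

/-- The divisibility in the centralizer is left as a hypothesis so that this step can be used inside
the induction proving it. -/
lemma ordCompl_dvd_card_isConj_pPart_of_centralizer {G : Type*} [Group G] [Finite G] {p : ℕ}
    (hp : p.Prime) {y : G} (hy : pPart p y = y)
    (h : Nat.card (Subgroup.centralizer ({y} : Set G)) /
      p ^ (Nat.card (Subgroup.centralizer ({y} : Set G))).factorization p ∣
        cardRegular p (Subgroup.centralizer ({y} : Set G))) :
    Nat.card G / p ^ (Nat.card G).factorization p ∣
      Nat.card {g : G // IsConj y (pPart p g)} := by
  rw [card_isConj_pPart hp hy, ← card_conj_mul_card_centralizer y, Nat.ordCompl_mul]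
  exact Nat.mul_dvd_mul (Nat.ordCompl_dvd _ _) h

lemma sum_card_pPart_conjClasses {G : Type*} [Group G] [Finite G] [Fintype (ConjClasses G)]
    (p : ℕ) :
    ∑ c : ConjClasses G, Nat.card {g : G // ConjClasses.mk (pPart p g) = c} = Nat.card G := by
  rw [← Nat.card_sigma]
  exact Nat.card_congr (Equiv.sigmaFiberEquiv _)

lemma card_mk_pPart {G : Type*} [Group G] (p : ℕ) (y : G) :
    Nat.card {g : G // ConjClasses.mk (pPart p g) = ConjClasses.mk y} =
      Nat.card {g : G // IsConj y (pPart p g)} :=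
  Nat.card_congr (Equiv.subtypeEquivRight fun _ => by
    rw [ConjClasses.mk_eq_mk_iff_isConj, isConj_comm])

/-- A special case of a theorem of Frobenius: the number of `p`-regular elements is divisible by
the `p'`-part of the order of the group. -/
theorem ordCompl_dvd_cardRegular.{u} {p : ℕ} (hp : p.Prime) :
    ∀ (n : ℕ) (G : Type u) [Group G] [Finite G], Nat.card G = n →
      Nat.card G / p ^ (Nat.card G).factorization p ∣ cardRegular p G := by
  intro n
  induction n using Nat.strong_induction_on with
  | _ n ih =>
    intro G _ _ hn
    classical
    have := Fintype.ofFinite (ConjClasses G)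
    have hsum := sum_card_pPart_conjClasses (G := G) p
    -- The class of 1 contributes exactly the `p`-regular elements. The `p'`-part divides the whole
    -- sum |G|, so it suffices that it divides every other term.
    rw [← Finset.add_sum_erase _ _ (Finset.mem_univ (ConjClasses.mk 1))] at hsum
    have h1 : Nat.card {g : G // ConjClasses.mk (pPart p g) = ConjClasses.mk 1} =
        cardRegular p G := by
      refine Nat.card_congr (Equiv.subtypeEquivRight fun g => ?_)
      rw [ConjClasses.mk_eq_mk_iff_isConj, isConj_one_left, pPart_eq_one_iff hp]
    rw [h1] at hsum
    have hdvd := Nat.ordCompl_dvd (Nat.card G) p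
    nth_rw 3 [← hsum] at hdvd
    refine (Nat.dvd_add_left ?_).1 hdvd
    refine Finset.dvd_sum fun c hc => ?_
    by_cases hne : ∃ g : G, ConjClasses.mk (pPart p g) = c
    · obtain ⟨g, rfl⟩ := hne
      have hy : pPart p (pPart p g) = pPart p g := pPart_pPart hp g
      have hy1 : pPart p g ≠ 1 := fun h => (Finset.ne_of_mem_erase hc) (by rw [h])
      generalize pPart p g = y at hy hy1
      have := ordCompl_dvd_card_isConj_pPart_of_centralizer hp hy ?_
      · rwa [card_mk_pPart]
      obtain ⟨Z, hZ, hcard, hreg⟩ := exists_quotient_cardRegular_centralizer hp hy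
      obtain ⟨i, hi⟩ := orderOf_eq_prime_pow_of_pPart_eq hp hy
      have hmul := Z.card_eq_card_quotient_mul_card_subgroup
      -- Dividing C(y) by ⟨y⟩ changes neither the `p'`-part of its order nor the regular count, but
      -- makes the group strictly smaller than G, even when y is central.
      rw [← hreg, hmul, Nat.ordCompl_mul, hcard, hi, hp.factorization_pow, Finsupp.single_eq_same,
        Nat.div_self (pow_pos hp.pos _), mul_one]
      refine ih _ ?_ _ rfl
      rw [← hn]
      have h2 : 1 < Nat.card Z := by
        rw [hcard, ← not_le, Nat.le_one_iff_eq_zero_or_eq_one, orderOf_eq_one_iff]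
        exact fun h => h.elim (orderOf_pos y).ne' hy1
      have h3 : 0 < Nat.card (Subgroup.centralizer ({y} : Set G) ⧸ Z) := Nat.card_pos
      have h4 := Subgroup.card_le_card_group (Subgroup.centralizer ({y} : Set G))
      nlinarith
    · have : IsEmpty {g : G // ConjClasses.mk (pPart p g) = c} :=
        ⟨fun g => hne ⟨g.1, g.2⟩⟩
      simp

lemma ordCompl_dvd_card_isConj_pPart {G : Type*} [Group G] [Finite G] {p : ℕ}
    (hp : p.Prime) {y : G} (hy : pPart p y = y) :
    Nat.card G / p ^ (Nat.card G).factorization p ∣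
      Nat.card {g : G // IsConj y (pPart p g)} :=
  ordCompl_dvd_card_isConj_pPart_of_centralizer hp hy (ordCompl_dvd_cardRegular hp _ _ rfl)

end Frobenius

/-! ### Exponents of `rho G`: divisibility, parity and the minimal case -/

section Rho

variable {G : Type*} [Group G]

lemma rho_congr {H : Type*} [Group H] (e : G ≃* H) : rho G = rho H :=
  finprod_eq_of_bijective e e.bijective fun g => (e.orderOf_eq g).symm

variable [Finite G]

lemma rho_ne_zero : rho G ≠ 0 := by
  have := Fintype.ofFinite G
  rw [rho, finprod_eq_prod_of_fintype]
  exact Finset.prod_ne_zero_iff.2 fun g _ => (orderOf_pos g).ne'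

lemma factorization_rho [Fintype G] (p : ℕ) :
    (rho G).factorization p = ∑ g : G, (orderOf g).factorization p := by
  rw [rho, finprod_eq_prod_of_fintype, Nat.factorization_prod fun g _ => (orderOf_pos g).ne']
  simp

lemma primeFactors_rho : (rho G).primeFactors = (Nat.card G).primeFactors := by
  have := Fintype.ofFinite G
  ext p
  simp only [Nat.mem_primeFactors, rho_ne_zero, Nat.card_pos.ne', ne_eq, not_false_eq_true,
    and_true, and_congr_right_iff]
  intro hp
  rw [rho, finprod_eq_prod_of_fintype]
  refine ⟨fun h => ?_, fun h => h.trans (Group.card_dvd_prod_orderOf G)⟩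
  obtain ⟨g, -, hg⟩ := (hp.prime.dvd_finsetProd_iff _).1 h
  exact hg.trans (orderOf_dvd_natCard g)

lemma mem_expRho {n : ℕ} : n ∈ expRho G ↔
    ∃ p, p.Prime ∧ p ∣ Nat.card G ∧ (rho G).factorization p = n := by
  simp [expRho, expSet, primeFactors_rho, Nat.card_pos.ne', and_assoc]

lemma factorization_orderOf_pPart {p : ℕ} (hp : p.Prime) (g : G) :
    (orderOf (pPart p g)).factorization p = (orderOf g).factorization p := by
  have hc : Commute (pPart p g) ((pPart p g)⁻¹ * g) :=
    ((Commute.refl _).inv_right).mul_right (commute_pPart g)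
  obtain ⟨i, hi⟩ := orderOf_eq_prime_pow_of_pPart_eq hp (pPart_pPart hp g)
  have hz := not_dvd_orderOf_pPart_inv_mul hp g
  have h := hc.orderOf_mul_eq_mul_orderOf_of_coprime
    (by rw [hi]; exact (hp.coprime_iff_not_dvd.2 hz).pow_left _)
  rw [mul_inv_cancel_left] at h
  rw [h, Nat.factorization_mul (orderOf_pos _).ne' (orderOf_pos _).ne', Finsupp.add_apply,
    Nat.factorization_eq_zero_of_not_dvd hz, add_zero]

lemma factorization_orderOf_of_isConj {p : ℕ} (hp : p.Prime) {y g : G}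
    (h : IsConj y (pPart p g)) : (orderOf g).factorization p = (orderOf y).factorization p := by
  obtain ⟨c, hc⟩ := isConj_iff.1 h
  rw [← factorization_orderOf_pPart hp, ← hc]
  exact congrArg (fun n => n.factorization p) ((MulAut.conj c).orderOf_eq y)

/-- The power of p in the order of g depends only on the conjugacy class of the `p`-part of g.
Classes not consisting of `p`-elements have empty fibres and add nothing. -/
lemma factorization_rho_eq_sum_conjClasses [Fintype (ConjClasses G)] {p : ℕ} (hp : p.Prime) :
    (rho G).factorization p = ∑ c : ConjClasses G,
      Nat.card {g : G // ConjClasses.mk (pPart p g) = c} * (orderOf c.out).factorization p := by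
  classical
  have := Fintype.ofFinite G
  rw [factorization_rho, ← Finset.sum_fiberwise _ fun g => ConjClasses.mk (pPart p g)]
  refine Finset.sum_congr rfl fun c _ => ?_
  rw [Nat.card_eq_fintype_card, Fintype.card_subtype]
  refine Finset.sum_const_nat fun g hg => factorization_orderOf_of_isConj hp ?_
  rw [← ConjClasses.mk_eq_mk_iff_isConj, (Finset.mem_filter.1 hg).2]
  exact Quotient.out_eq c

lemma ordCompl_dvd_card_mk_pPart {p : ℕ} (hp : p.Prime) (c : ConjClasses G) :
    Nat.card G / p ^ (Nat.card G).factorization p ∣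
      Nat.card {g : G // ConjClasses.mk (pPart p g) = c} := by
  by_cases hne : ∃ g : G, ConjClasses.mk (pPart p g) = c
  · obtain ⟨g, rfl⟩ := hne
    rw [card_mk_pPart]
    exact ordCompl_dvd_card_isConj_pPart hp (pPart_pPart hp g)
  · have : IsEmpty {g : G // ConjClasses.mk (pPart p g) = c} :=
      ⟨fun g => hne ⟨g.1, g.2⟩⟩
    simp

theorem ordCompl_dvd_factorization_rho {p : ℕ} (hp : p.Prime) :
    Nat.card G / p ^ (Nat.card G).factorization p ∣ (rho G).factorization p := by
  have := Fintype.ofFinite (ConjClasses G)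
  rw [factorization_rho_eq_sum_conjClasses hp]
  exact Finset.dvd_sum fun c _ => (ordCompl_dvd_card_mk_pPart hp c).mul_right _

/-- Pair g with g⁻¹, which has the same order. A fixed point satisfies g² = 1 and contributes zero
because p is odd. -/
lemma even_factorization_rho {p : ℕ} (hp : p.Prime) (hp2 : p ≠ 2) :
    Even ((rho G).factorization p) := by
  have := Fintype.ofFinite G
  rw [even_iff_two_dvd, ← ZMod.natCast_eq_zero_iff, factorization_rho, Nat.cast_sum]
  refine Finset.sum_involution (fun g _ => g⁻¹) (fun g _ => ?_) (fun g _ h hg => h ?_)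
    (fun _ _ => Finset.mem_univ _) (fun g _ => inv_inv g)
  · rw [orderOf_inv, ← two_mul]
    exact zero_mul _
  · have h2 : orderOf g ∣ 2 := orderOf_dvd_of_pow_eq_one (by
      rw [pow_two]; nth_rw 1 [← hg]; exact inv_mul_cancel g)
    rw [Nat.factorization_eq_zero_of_not_dvd, Nat.cast_zero]
    exact fun hd => hp2 ((Nat.prime_dvd_prime_iff_eq hp Nat.prime_two).1 (hd.trans h2))

/-- If the exponent of `p` in `rho G` is as small as possible, then all nontrivial `p`-elements are
conjugate and have order `p`. -/
theorem isConj_of_factorization_rho_eq {p : ℕ} (hp : p.Prime)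
    (h : (rho G).factorization p = Nat.card G / p ^ (Nat.card G).factorization p)
    {y z : G} (hy : pPart p y = y) (hz : pPart p z = z) (hy1 : y ≠ 1) (hz1 : z ≠ 1) :
    orderOf y = p ∧ IsConj y z := by
  classical
  have := Fintype.ofFinite (ConjClasses G)
  set m := Nat.card G / p ^ (Nat.card G).factorization p with hm
  have hm0 : 0 < m := Nat.ordCompl_pos p Nat.card_pos.ne'
  -- A nontrivial class of `p`-elements contributes at least m times the exponent of its order.
  -- Since the total is m, neither an exponent 2 nor a second class fits.
  have key : ∀ x : G, pPart p x = x → x ≠ 1 → m * (orderOf x).factorization p ≤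
      Nat.card {g : G // ConjClasses.mk (pPart p g) = ConjClasses.mk x} *
        (orderOf (ConjClasses.mk x).out).factorization p ∧
      1 ≤ (orderOf x).factorization p := by
    intro x hx hx1
    have h1 : IsConj (ConjClasses.mk x).out (pPart p x) := by
      rw [hx, ← ConjClasses.mk_eq_mk_iff_isConj]; exact Quotient.out_eq _
    rw [factorization_orderOf_of_isConj hp h1]
    constructor
    · gcongr
      refine Nat.le_of_dvd ?_ (ordCompl_dvd_card_mk_pPart hp _)
      have : Nonempty {g : G // ConjClasses.mk (pPart p g) = ConjClasses.mk x} := ⟨x, by rw [hx]⟩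
      exact Nat.card_pos
    · rw [← factorization_orderOf_of_isConj hp h1]
      refine hp.factorization_pos_of_dvd (orderOf_pos x).ne' ?_
      by_contra hd
      exact hx1 (hx ▸ (pPart_eq_one_iff hp).2 hd)
  have hs := factorization_rho_eq_sum_conjClasses (G := G) hp
  rw [h] at hs
  obtain ⟨ky, ky1⟩ := key y hy hy1
  obtain ⟨kz, kz1⟩ := key z hz hz1
  constructor
  · have h1 := Finset.single_le_sum (f := fun c : ConjClasses G =>
      Nat.card {g : G // ConjClasses.mk (pPart p g) = c} * (orderOf c.out).factorization p)
      (fun _ _ => Nat.zero_le _) (Finset.mem_univ (ConjClasses.mk y))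
    obtain ⟨i, hi⟩ := orderOf_eq_prime_pow_of_pPart_eq hp hy
    rw [hi, hp.factorization_pow, Finsupp.single_eq_same] at ky ky1
    have h2 : m * i ≤ m * 1 := by rw [mul_one]; exact ky.trans (h1.trans hs.ge)
    have : i = 1 := le_antisymm (Nat.le_of_mul_le_mul_left h2 hm0) ky1
    rw [hi, this, pow_one]
  · by_contra hne
    have hne' : ConjClasses.mk y ≠ ConjClasses.mk z := fun h =>
      hne (ConjClasses.mk_eq_mk_iff_isConj.1 h)
    have h1 := Finset.sum_le_sum_of_subset (f := fun c : ConjClasses G =>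
      Nat.card {g : G // ConjClasses.mk (pPart p g) = c} * (orderOf c.out).factorization p)
      (Finset.subset_univ {ConjClasses.mk y, ConjClasses.mk z})
    rw [Finset.sum_pair hne', ← hs] at h1
    nlinarith

end Rho

/-! ### Sylow subgroups of prime order -/

section SylowPrimeOrder

variable {G : Type*} [Group G] [Finite G] {p : ℕ}

lemma card_sylow_of_factorization_eq_one [Fact p.Prime]
    (h1 : (Nat.card G).factorization p = 1) (P : Sylow p G) : Nat.card P = p := by
  rw [P.card_eq_multiplicity, h1, pow_one]

lemma zpowers_eq_of_mem_of_card_eq_prime (hp : p.Prime) {P : Subgroup G} (hP : Nat.card P = p)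
    {y : G} (hy : y ∈ P) (hy1 : y ≠ 1) : Subgroup.zpowers y = P := by
  have hle : Subgroup.zpowers y ≤ P := Subgroup.zpowers_le.2 hy
  refine Subgroup.eq_of_le_of_card_ge hle ?_
  have h := Subgroup.card_dvd_of_le hle
  rw [hP, Nat.card_zpowers, Nat.dvd_prime hp, orderOf_eq_one_iff] at h
  rw [hP, Nat.card_zpowers, h.resolve_left hy1]

lemma centralizer_singleton_eq_of_card_eq_prime (hp : p.Prime) {P : Subgroup G}
    (hP : Nat.card P = p) {y : G} (hy : y ∈ P) (hy1 : y ≠ 1) :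
    Subgroup.centralizer ({y} : Set G) = Subgroup.centralizer (P : Set G) := by
  rw [← zpowers_eq_of_mem_of_card_eq_prime hp hP hy hy1, Subgroup.zpowers_eq_closure,
    Subgroup.centralizer_closure]

omit [Finite G] in
lemma orderOf_of_mem_of_card_eq_prime (hp : p.Prime) {P : Subgroup G} (hP : Nat.card P = p)
    {y : G} (hy : y ∈ P) (hy1 : y ≠ 1) : orderOf y = p := by
  have h := P.orderOf_dvd_natCard hy
  rw [hP, Nat.dvd_prime hp, orderOf_eq_one_iff] at h
  exact h.resolve_left hy1

lemma card_centralizer_of_isConj {y z : G} (h : IsConj y z) :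
    Nat.card (Subgroup.centralizer ({y} : Set G)) =
      Nat.card (Subgroup.centralizer ({z} : Set G)) := by
  have h1 := card_conj_mul_card_centralizer y
  rw [← card_conj_mul_card_centralizer z] at h1
  have h2 : Nat.card {x : G // IsConj y x} = Nat.card {x : G // IsConj z x} :=
    Nat.card_congr (Equiv.subtypeEquivRight fun x => ⟨h.symm.trans, h.trans⟩)
  rw [h2] at h1
  have : Nonempty {x : G // IsConj z x} := ⟨z, IsConj.refl z⟩
  exact Nat.eq_of_mul_eq_mul_left Nat.card_pos h1

lemma exists_isConj_mem_sylow [Fact p.Prime] (P : Sylow p G) {y : G} {i : ℕ}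
    (hy : y ^ p ^ i = 1) : ∃ z ∈ P, IsConj y z := by
  obtain ⟨Q, hQ⟩ := (isPGroup_zpowers hy).exists_le_sylow
  obtain ⟨g, rfl⟩ := MulAction.exists_smul_eq G Q P
  refine ⟨g * y * g⁻¹, ?_, isConj_iff.2 ⟨g, rfl⟩⟩
  exact Subgroup.smul_mem_pointwise_smul y (MulAut.conj g) (Q : Subgroup G)
    (hQ (Subgroup.mem_zpowers y))

/-- Distinct subgroups of order p meet trivially, so each element of order p lies in exactly one
Sylow subgroup. -/
lemma card_orderOf_eq_prime [hp : Fact p.Prime] (h1 : (Nat.card G).factorization p = 1) :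
    Nat.card {y : G // orderOf y = p} = Nat.card (Sylow p G) * (p - 1) := by
  have := Fintype.ofFinite (Sylow p G)
  have hP := card_sylow_of_factorization_eq_one h1
  have h : Nat.card (Σ P : Sylow p G, {x : P // x ≠ 1}) = Nat.card (Sylow p G) * (p - 1) := by
    rw [Nat.card_sigma, Nat.card_eq_fintype_card]
    refine Finset.sum_const_nat fun P _ => ?_
    have := Fintype.ofFinite P
    classical
    rw [Nat.card_eq_fintype_card, Fintype.card_subtype_compl, Fintype.card_subtype_eq,
      ← Nat.card_eq_fintype_card]
    exact congrArg (· - 1) (hP P)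
  rw [← h]
  symm
  refine Nat.card_congr (Equiv.ofBijective (fun x => ⟨x.2.1.1,
    orderOf_of_mem_of_card_eq_prime hp.out (hP x.1) x.2.1.2 (by simpa using x.2.2)⟩) ⟨?_, ?_⟩)
  · rintro ⟨P, ⟨x, hx⟩, hx1⟩ ⟨Q, ⟨y, hy⟩, hy1⟩ hxy
    obtain rfl : x = y := congrArg Subtype.val hxy
    have hx1' : x ≠ 1 := fun h => hx1 (Subtype.ext h)
    obtain rfl : P = Q := Sylow.ext
      ((zpowers_eq_of_mem_of_card_eq_prime hp.out (hP P) hx hx1').symm.trans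
        (zpowers_eq_of_mem_of_card_eq_prime hp.out (hP Q) hy hx1'))
    rfl
  · rintro ⟨y, hy⟩
    have hy' : y ^ p ^ 1 = 1 := by rw [pow_one, ← hy, pow_orderOf_eq_one]
    obtain ⟨Q, hQ⟩ := (isPGroup_zpowers hy').exists_le_sylow
    refine ⟨⟨Q, ⟨y, hQ (Subgroup.mem_zpowers y)⟩, fun h => ?_⟩, rfl⟩
    have : y = 1 := congrArg Subtype.val h
    rw [this, orderOf_one] at hy
    exact hp.out.one_lt.ne hy

/-- As p² does not divide |G|, the quotient C(y)/⟨y⟩ has order prime to p and all its elements are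
`p`-regular. Moving y into P by conjugation replaces C(y) by C(P). -/
lemma prime_mul_card_pPart_eq [hp : Fact p.Prime] (h1 : (Nat.card G).factorization p = 1)
    (P : Sylow p G) {y : G} (hy : orderOf y = p) :
    p * Nat.card {g : G // pPart p g = y} =
      Nat.card (Subgroup.centralizer ((P : Subgroup G) : Set G)) := by
  have hy' : y ^ p ^ 1 = 1 := by rw [pow_one, ← hy, pow_orderOf_eq_one]
  have hyy : pPart p y = y := pPart_of_pow_eq_one hp.out (by rw [h1]; exact hy')
  obtain ⟨z, hz, hyz⟩ := exists_isConj_mem_sylow P hy'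
  have hz1 : z ≠ 1 := by
    rintro rfl
    rw [isConj_one_left] at hyz
    rw [hyz, orderOf_one] at hy
    exact hp.out.one_lt.ne hy
  rw [← centralizer_singleton_eq_of_card_eq_prime hp.out (card_sylow_of_factorization_eq_one h1 P)
    hz hz1, ← card_centralizer_of_isConj hyz, card_pPart_eq hp.out hyy]
  obtain ⟨Z, hZ, hcard, hreg⟩ := exists_quotient_cardRegular_centralizer hp.out hyy
  have hmul := Z.card_eq_card_quotient_mul_card_subgroup
  rw [← hreg, hmul, hcard, hy, mul_comm]
  congr 1
  have hnd : ¬ p ∣ Nat.card (Subgroup.centralizer ({y} : Set G) ⧸ Z) := by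
    intro hd
    have h2 : p ^ 2 ∣ Nat.card G := by
      rw [pow_two]
      refine dvd_trans ?_ (Subgroup.card_subgroup_dvd_card (Subgroup.centralizer ({y} : Set G)))
      rw [hmul, hcard, hy]
      exact mul_dvd_mul_right hd p
    rw [hp.out.pow_dvd_iff_le_factorization Nat.card_pos.ne', h1] at h2
    omega
  exact Nat.card_congr (Equiv.subtypeUnivEquiv fun x h => hnd (h.trans (orderOf_dvd_natCard x)))

lemma factorization_rho_eq_card (hp : p.Prime) (h1 : (Nat.card G).factorization p = 1) :
    (rho G).factorization p = Nat.card {g : G // p ∣ orderOf g} := by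
  classical
  have := Fintype.ofFinite G
  rw [factorization_rho, Nat.card_eq_fintype_card, Fintype.card_subtype, Finset.card_filter]
  refine Finset.sum_congr rfl fun g _ => ?_
  split_ifs with hd
  · refine le_antisymm ?_ (hp.factorization_pos_of_dvd (orderOf_pos g).ne' hd)
    rw [← h1]
    exact (Nat.factorization_le_iff_dvd (orderOf_pos g).ne' Nat.card_pos.ne').2
      (orderOf_dvd_natCard g) p
  · exact Nat.factorization_eq_zero_of_not_dvd hd

/-- The exponent counts the elements of order divisible by p. Sorted by `p`-part, they form n_p(p −
1) fibres of size |C(P)|/p, where n_p = |G : N(P)|; the identity is written without division. -/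
theorem factorization_rho_mul_card_normalizer [hp : Fact p.Prime]
    (h1 : (Nat.card G).factorization p = 1) (P : Sylow p G) :
    (rho G).factorization p *
        (p * Nat.card (Subgroup.normalizer ((P : Subgroup G) : Set G))) =
      Nat.card G * ((p - 1) * Nat.card (Subgroup.centralizer ((P : Subgroup G) : Set G))) := by
  have := Fintype.ofFinite {y : G // orderOf y = p}
  have hord : ∀ g : G, p ∣ orderOf g → orderOf (pPart p g) = p := fun g hg => by
    have h2 := orderOf_dvd_of_pow_eq_one (pPart_pow hp.out g)
    rw [h1, pow_one, Nat.dvd_prime hp.out, orderOf_eq_one_iff, pPart_eq_one_iff hp.out] at h2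
    exact h2.resolve_left (not_not.2 hg)
  let f : {g : G // p ∣ orderOf g} → {y : G // orderOf y = p} :=
    fun g => ⟨pPart p g.1, hord g.1 g.2⟩
  have h2 : p * Nat.card {g : G // p ∣ orderOf g} = Nat.card {y : G // orderOf y = p} *
      Nat.card (Subgroup.centralizer ((P : Subgroup G) : Set G)) := by
    rw [← Nat.card_congr (Equiv.sigmaFiberEquiv f), Nat.card_sigma, Finset.mul_sum,
      Nat.card_eq_fintype_card]
    refine Finset.sum_const_nat fun y _ => ?_
    rw [← prime_mul_card_pPart_eq h1 P y.2]
    congr 1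
    refine Nat.card_congr ⟨fun g => ⟨g.1.1, congrArg Subtype.val g.2⟩,
      fun g => ⟨⟨g.1, ?_⟩, Subtype.ext g.2⟩, fun _ => rfl, fun _ => rfl⟩
    by_contra hd
    have h3 := (pPart_eq_one_iff hp.out).2 hd
    have h4 := y.2
    rw [← g.2, h3, orderOf_one] at h4
    exact hp.out.one_lt.ne h4
  have h3 : Nat.card (Sylow p G) = (Subgroup.normalizer ((P : Subgroup G) : Set G)).index :=
    P.card_eq_index_normalizer
  have h4 := (Subgroup.normalizer ((P : Subgroup G) : Set G)).card_mul_index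
  rw [factorization_rho_eq_card hp.out h1, ← h4, ← h3]
  rw [card_orderOf_eq_prime h1] at h2
  calc _ = (p * Nat.card {g : G // p ∣ orderOf g}) *
        Nat.card (Subgroup.normalizer ((P : Subgroup G) : Set G)) := by ring
    _ = _ := by rw [h2]; ring

end SylowPrimeOrder

/-! ### From the exponent set to the order of G -/

section Structure

variable {G : Type*} [Group G] [Finite G] {q r : ℕ}

/-- The exponents of `rho G` determine the order of `G` up to a power of two. -/
theorem exists_card_eq_of_expRho_eq (hq : q.Prime) (hr : r.Prime) (hq2 : q ≠ 2) (hr2 : r ≠ 2)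
    (hqr : q ≠ r) (h : expRho G = {q * r, 2 * r * (q - 1), 2 * q * (r - 1)}) :
    (∃ a, Nat.card G = 2 ^ (a + 1) * (q * r)) ∧ (rho G).factorization 2 = q * r ∧
      (rho G).factorization q = 2 * r * (q - 1) ∧ (rho G).factorization r = 2 * q * (r - 1) := by
  have hodd : ¬ Even (q * r) := by
    rw [Nat.not_even_iff_odd]
    exact (hq.odd_of_ne_two hq2).mul (hr.odd_of_ne_two hr2)
  have hmem : ∀ p, p.Prime → p ∣ Nat.card G → (rho G).factorization p ∈ expRho G :=
    fun p hp hd => mem_expRho.2 ⟨p, hp, hd, rfl⟩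
  have hmem0 : q * r ∈ expRho G := by rw [h]; simp
  obtain ⟨p, hp, hpG, hpe⟩ := mem_expRho.1 hmem0
  obtain rfl : p = 2 := by
    by_contra hp2
    exact hodd (hpe ▸ even_factorization_rho hp hp2)
  set a := (Nat.card G).factorization 2 with ha
  have ha0 : 0 < a := hp.factorization_pos_of_dvd Nat.card_pos.ne' hpG
  have hdvd : Nat.card G / 2 ^ a ∣ q * r := hpe ▸ ordCompl_dvd_factorization_rho hp
  have hG : 2 ^ a * (Nat.card G / 2 ^ a) = Nat.card G := Nat.ordProj_mul_ordCompl_eq_self _ _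
  -- Three distinct exponents need three prime divisors, so none of 2, q, r can be missing.
  have hcard3 : (expRho G).card = 3 := by
    have h1 : 2 * r * (q - 1) ≠ 2 * q * (r - 1) := by
      obtain ⟨q, rfl⟩ := Nat.exists_eq_succ_of_ne_zero hq.ne_zero
      obtain ⟨r, rfl⟩ := Nat.exists_eq_succ_of_ne_zero hr.ne_zero
      simp only [Nat.succ_eq_add_one, Nat.add_sub_cancel] at *
      intro h
      apply hqr
      nlinarith
    have h2 : ∀ x, q * r ≠ 2 * x := fun x hx => hodd ⟨x, by rw [hx, two_mul]⟩
    rw [h, Finset.card_eq_three]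
    exact ⟨_, _, _, by rw [mul_assoc]; exact h2 _, by rw [mul_assoc 2 q]; exact h2 _, h1, rfl⟩
  have hsub : (Nat.card G).primeFactors ⊆ {2, q, r} := by
    intro p hp
    have hp' := Nat.prime_of_mem_primeFactors hp
    have hd := Nat.dvd_of_mem_primeFactors hp
    rw [← hG, hp'.dvd_mul] at hd
    simp only [Finset.mem_insert, Finset.mem_singleton]
    rcases hd with hd | hd
    · exact .inl ((Nat.prime_dvd_prime_iff_eq hp' Nat.prime_two).1 (hp'.dvd_of_dvd_pow hd))
    · rcases hp'.dvd_mul.1 (hd.trans hdvd) with hd | hd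
      · exact .inr (.inl ((Nat.prime_dvd_prime_iff_eq hp' hq).1 hd))
      · exact .inr (.inr ((Nat.prime_dvd_prime_iff_eq hp' hr).1 hd))
  have heq : (Nat.card G).primeFactors = {2, q, r} := by
    refine Finset.eq_of_subset_of_card_le hsub (Finset.card_le_three.trans ?_)
    rw [← hcard3, ← primeFactors_rho]
    exact Finset.card_image_le
  have hqG : q ∣ Nat.card G := Nat.dvd_of_mem_primeFactors (by rw [heq]; simp)
  have hrG : r ∣ Nat.card G := Nat.dvd_of_mem_primeFactors (by rw [heq]; simp)
  have hcop : ∀ p, p.Prime → p ≠ 2 → p ∣ Nat.card G → p ∣ Nat.card G / 2 ^ a := by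
    intro p hp' hp2 hd
    rw [← hG] at hd
    exact (Nat.Coprime.pow_right a ((Nat.coprime_primes hp' hp).2 hp2)).dvd_of_dvd_mul_left hd
  have hm : Nat.card G / 2 ^ a = q * r := Nat.dvd_antisymm hdvd
    (((Nat.coprime_primes hq hr).2 hqr).mul_dvd_of_dvd_of_dvd (hcop q hq hq2 hqG)
      (hcop r hr hr2 hrG))
  rw [hm] at hG
  have hmain : ∀ q r : ℕ, q.Prime → r.Prime → q ≠ 2 → q ≠ r → r ≠ 2 → ¬ Even (q * r) →
      2 ^ a * (q * r) = Nat.card G →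
      (rho G).factorization q ∈ ({q * r, 2 * r * (q - 1), 2 * q * (r - 1)} : Finset ℕ) →
      (rho G).factorization q = 2 * r * (q - 1) := by
    intro q r hq hr hq2 hqr hr2 hodd hG hmem
    simp only [Finset.mem_insert, Finset.mem_singleton] at hmem
    have hev := even_factorization_rho (G := G) hq hq2
    rcases hmem with h1 | h1 | h1
    · exact absurd (h1 ▸ hev) hodd
    · exact h1
    · exfalso
      -- The `q'`-part of |G| contains r, and r does not divide 2q(r − 1): this separates the two
      -- even exponents.
      have hrd : r ∣ (rho G).factorization q := by
        refine dvd_trans ?_ (ordCompl_dvd_factorization_rho hq)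
        have h2 : r ∣ Nat.card G := ⟨2 ^ a * q, by rw [← hG]; ring⟩
        rw [← Nat.ordProj_mul_ordCompl_eq_self (Nat.card G) q] at h2
        exact (Nat.Coprime.pow_right _
          ((Nat.coprime_primes hr hq).2 hqr.symm)).dvd_of_dvd_mul_left h2
      rw [h1, hr.dvd_mul, hr.dvd_mul, Nat.prime_dvd_prime_iff_eq hr Nat.prime_two,
        Nat.prime_dvd_prime_iff_eq hr hq] at hrd
      rcases hrd with (h2 | h2) | h2
      · exact hr2 h2
      · exact hqr h2.symm
      · have := Nat.le_of_dvd (by have := hr.two_le; omega) h2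
        have := hr.two_le
        omega
  refine ⟨⟨a - 1, by rw [Nat.sub_add_cancel ha0, hG]⟩, hpe,
    hmain q r hq hr hq2 hqr hr2 hodd hG (h ▸ hmem q hq hqG),
    hmain r q hr hq hr2 hqr.symm hq2 (by rwa [mul_comm]) (by rw [mul_comm r, hG]) ?_⟩
  have := hmem r hr hrG
  rw [h] at this
  simp only [Finset.mem_insert, Finset.mem_singleton] at this ⊢
  rw [mul_comm r q]
  tauto

end Structure

/-! ### Automizers and Burnside transfer -/

section NormalizerCentralizer

variable {G : Type*} [Group G] [Finite G]

omit [Finite G] in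
lemma card_normalizerMonoidHom_range_mul (P : Subgroup G) :
    Nat.card P.normalizerMonoidHom.range * Nat.card (Subgroup.centralizer (P : Set G)) =
      Nat.card (Subgroup.normalizer (P : Set G)) := by
  rw [← Subgroup.card_mul_index P.normalizerMonoidHom.ker, Subgroup.index_ker, mul_comm,
    Subgroup.normalizerMonoidHom_ker]
  congr 1
  exact (Nat.card_congr
    (Subgroup.subgroupOfEquivOfLe (Subgroup.centralizer_le_normalizer _)).toEquiv).symm

lemma normalizer_le_centralizer_of_card_le {P : Subgroup G}
    (h : Nat.card (Subgroup.normalizer (P : Set G)) ≤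
      Nat.card (Subgroup.centralizer (P : Set G))) :
    Subgroup.normalizer (P : Set G) ≤ Subgroup.centralizer (P : Set G) :=
  (Subgroup.eq_of_le_of_card_ge (Subgroup.centralizer_le_normalizer _) h).ge

/-- If the `2`-elements are involutions, a `2`-group of automorphisms induced on a subgroup of
prime order has order at most two. -/
lemma le_one_of_card_normalizerMonoidHom_range_eq {p b : ℕ} (hp : p.Prime) {P : Subgroup G}
    (hP : Nat.card P = p) (hb : Nat.card P.normalizerMonoidHom.range = 2 ^ b)
    (h2 : ∀ g : G, pPart 2 g ^ 2 = 1) : b ≤ 1 := by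
  have := Fact.mk hp
  have : IsCyclic P := isCyclic_of_prime_card hP
  have : IsCyclic (ZMod (Nat.card P))ˣ := by rw [hP]; infer_instance
  have : IsCyclic (MulAut P) := (IsCyclic.mulAutMulEquiv P).isCyclic.2 this
  obtain ⟨⟨x, hx⟩, hgen⟩ := IsCyclic.exists_generator (α := P.normalizerMonoidHom.range)
  have hord : orderOf x = 2 ^ b := by
    rw [← hb, ← orderOf_eq_card_of_forall_mem_zpowers hgen, Subgroup.orderOf_mk]
  obtain ⟨g, rfl⟩ := hx
  set x := P.normalizerMonoidHom g
  have hba : b ≤ (Nat.card G).factorization 2 := by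
    rw [← Nat.prime_two.pow_dvd_iff_le_factorization Nat.card_pos.ne', ← hord]
    exact (orderOf_map_dvd _ g).trans
      ((orderOf_dvd_natCard g).trans (Subgroup.card_subgroup_dvd_card _))
  -- Raising to this power fixes x, which is a 2-element, but replaces its lift g by the 2-part of
  -- g, whose square is 1. So x² = 1.
  have hx1 : x ^ pPartExponent 2 (Nat.card G) = x := by
    refine pow_pPartExponent_of_pow_eq_one Nat.prime_two Nat.card_pos.ne' ?_
    rw [← orderOf_dvd_iff_pow_eq_one, hord]
    exact pow_dvd_pow 2 hba
  have hx2 : x ^ 2 = 1 := by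
    rw [← hx1, ← map_pow, ← map_pow]
    convert map_one P.normalizerMonoidHom
    exact Subtype.ext (h2 g.1)
  have := orderOf_dvd_of_pow_eq_one hx2
  rw [hord] at this
  exact (Nat.pow_dvd_pow_iff_le_right (x := 2) (by norm_num)).1 (by simpa using this)

-- Here P is abelian, so the transfer into P kills commutators, and its kernel has order prime to p
-- by Burnside.
open scoped commutatorElement in
lemma not_dvd_orderOf_commutator {p : ℕ} [Fact p.Prime] (P : Sylow p G)
    (hP : Subgroup.normalizer ((P : Subgroup G) : Set G) ≤
      Subgroup.centralizer ((P : Subgroup G) : Set G)) (g h : G) :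
    ¬ p ∣ orderOf ⁅g, h⁆ := by
  have hc : ∀ a b : P, a * b = b * a := fun a b =>
    Subtype.ext (hP (Subgroup.le_normalizer b.2) a a.2)
  intro hd
  have hmem : ⁅g, h⁆ ∈ (MonoidHom.transferSylow P hP).ker := by
    rw [MonoidHom.mem_ker, map_commutatorElement, commutatorElement_eq_one_iff_mul_comm]
    exact hc _ _
  exact MonoidHom.not_dvd_card_ker_transferSylow P hP
    (hd.trans (Subgroup.orderOf_dvd_natCard _ hmem))

/-- The transfer into the abelian group P agrees on conjugates, and its kernel meets P trivially. -/
lemma eq_of_isConj_of_mem_sylow {p : ℕ} [Fact p.Prime] (P : Sylow p G)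
    (hP : Subgroup.normalizer ((P : Subgroup G) : Set G) ≤
      Subgroup.centralizer ((P : Subgroup G) : Set G)) {y z : G} (hy : y ∈ P) (hz : z ∈ P)
    (h : IsConj y z) : y = z := by
  have hc : ∀ a b : P, a * b = b * a := fun a b =>
    Subtype.ext (hP (Subgroup.le_normalizer b.2) a a.2)
  have hmem : y * z⁻¹ ∈ (MonoidHom.transferSylow P hP).ker ⊓ (P : Subgroup G) := by
    refine ⟨?_, (P : Subgroup G).mul_mem hy ((P : Subgroup G).inv_mem hz)⟩
    obtain ⟨c, rfl⟩ := isConj_iff.1 h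
    change MonoidHom.transferSylow P hP (y * (c * y * c⁻¹)⁻¹) = 1
    simp only [map_mul, map_inv]
    rw [hc (MonoidHom.transferSylow P hP c), mul_inv_cancel_right, mul_inv_cancel]
  rw [(MonoidHom.ker_transferSylow_disjoint P hP P P.isPGroup').eq_bot, Subgroup.mem_bot] at hmem
  exact mul_inv_eq_one.1 hmem

end NormalizerCentralizer

/-! ### The case a = 0: cyclic groups -/

section Cyclic

variable {G : Type*} [Group G] [Finite G] {q r : ℕ}

lemma nonempty_mulEquiv_zmod_of_normalizer_le (hq : q.Prime) (hr : r.Prime) (hq2 : q ≠ 2)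
    (hr2 : r ≠ 2) (hqr : q ≠ r) (hG : Nat.card G = 2 * q * r)
    (h : ∀ p, p = q ∨ p = r → ∀ P : Sylow p G,
      Subgroup.normalizer ((P : Subgroup G) : Set G) ≤
        Subgroup.centralizer ((P : Subgroup G) : Set G)) :
    Nonempty (G ≃* Multiplicative (ZMod (2 * q * r))) := by
  have hsq : Squarefree (Nat.card G) := by
    rw [hG, Nat.squarefree_mul_iff, Nat.squarefree_mul_iff]
    exact ⟨Nat.Coprime.mul_left ((Nat.coprime_primes Nat.prime_two hr).2 hr2.symm)
      ((Nat.coprime_primes hq hr).2 hqr), ⟨(Nat.coprime_primes Nat.prime_two hq).2 hq2.symm,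
      Nat.prime_two.prime.squarefree, hq.prime.squarefree⟩, hr.prime.squarefree⟩
  have hZ : IsZGroup G := IsZGroup.of_squarefree hsq
  have hcomm : ∀ a b : G, a * b = b * a := by
    intro a b
    rw [← commutatorElement_eq_one_iff_mul_comm, ← orderOf_eq_one_iff]
    by_contra hne
    obtain ⟨p, hp, hd⟩ := Nat.exists_prime_and_dvd hne
    have := Fact.mk hp
    obtain ⟨P⟩ : Nonempty (Sylow p G) := inferInstance
    refine not_dvd_orderOf_commutator P ?_ a b hd
    have hpG := hd.trans (orderOf_dvd_natCard _)
    rw [hG, hp.dvd_mul, hp.dvd_mul, Nat.prime_dvd_prime_iff_eq hp hq,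
      Nat.prime_dvd_prime_iff_eq hp hr, Nat.prime_dvd_prime_iff_eq hp Nat.prime_two] at hpG
    rcases hpG with (rfl | rfl) | rfl
    -- For the smallest prime 2 a cyclic Sylow subgroup satisfies N ≤ C automatically.
    · refine IsCyclic.normalizer_le_centralizer ?_ inferInstance
      rw [Nat.minFac_eq_two_iff, hG, mul_assoc]
      exact dvd_mul_right _ _
    · exact h p (.inl rfl) P
    · exact h p (.inr rfl) P
  let _ : CommGroup G := { mul_comm := hcomm }
  have : NeZero (2 * q * r) := ⟨by rw [← hG]; exact Nat.card_pos.ne'⟩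
  have hcyc : IsCyclic G := inferInstance
  exact ⟨mulEquivOfCyclicCardEq (by rw [hG]; simp)⟩

end Cyclic

/-! ### Sylow 2-subgroups of order four with conjugate involutions -/

section KleinSylow

variable {G : Type*} [Group G] [Finite G]

/-- Nontrivial `2`-elements are conjugate involutions. -/
def HasConjInvolutions (G : Type*) [Group G] : Prop :=
  ∀ y z : G, pPart 2 y = y → pPart 2 z = z → y ≠ 1 → z ≠ 1 → orderOf y = 2 ∧ IsConj y z

omit [Finite G] in
lemma HasConjInvolutions.pow_two (h : HasConjInvolutions G) {y : G} (hy : pPart 2 y = y) :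
    y ^ 2 = 1 := by
  by_cases h1 : y = 1
  · rw [h1, one_pow]
  · rw [← (h y y hy hy h1 h1).1, pow_orderOf_eq_one]

lemma pPart_eq_of_pow_eq_one {p : ℕ} (hp : p.Prime) {y : G} {i : ℕ} (hy : y ^ p ^ i = 1) :
    pPart p y = y := by
  obtain ⟨j, -, hj⟩ := (Nat.dvd_prime_pow hp).1 (orderOf_dvd_of_pow_eq_one hy)
  refine pPart_of_pow_eq_one hp (orderOf_dvd_iff_pow_eq_one.1 ?_)
  rw [hj]
  exact pow_dvd_pow p ((hp.pow_dvd_iff_le_factorization Nat.card_pos.ne').1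
    (hj ▸ orderOf_dvd_natCard y))

lemma pPart_eq_of_mem_isPGroup {p : ℕ} (hp : p.Prime) {P : Subgroup G} (hP : IsPGroup p P)
    {y : G} (hy : y ∈ P) : pPart p y = y := by
  obtain ⟨i, hi⟩ := hP ⟨y, hy⟩
  exact pPart_eq_of_pow_eq_one hp (i := i) (congrArg Subtype.val hi)

/-- By Cauchy K contains an involution, and by normality all its conjugates, which are all the
nontrivial 2-elements. -/
lemma HasConjInvolutions.le_of_normal (h : HasConjInvolutions G) {K : Subgroup G} (hK : K.Normal)
    (h2 : 2 ∣ Nat.card K) {P : Subgroup G} (hP : IsPGroup 2 P) : P ≤ K := by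
  obtain ⟨⟨t, htK⟩, ht⟩ := exists_prime_orderOf_dvd_card' 2 h2
  rw [Subgroup.orderOf_mk] at ht
  intro y hy
  by_cases hy1 : y = 1
  · rw [hy1]; exact K.one_mem
  have ht1 : t ≠ 1 := by rintro rfl; simp at ht
  have htt : pPart 2 t = t := pPart_eq_of_pow_eq_one Nat.prime_two (i := 1)
    (by rw [pow_one, ← ht, pow_orderOf_eq_one])
  obtain ⟨c, rfl⟩ := isConj_iff.1
    (h t y htt (pPart_eq_of_mem_isPGroup Nat.prime_two hP hy) ht1 hy1).2
  exact hK.conj_mem t htK c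

/-- Automorphisms act faithfully on the three nonidentity elements. -/
lemma card_mulAut_dvd_six {P : Type*} [Group P] (hP : Nat.card P = 4) :
    Nat.card (MulAut P) ∣ 6 := by
  classical
  have : Finite P := Nat.finite_of_card_ne_zero (by rw [hP]; norm_num)
  have := Fintype.ofFinite P
  let f : MulAut P →* Equiv.Perm {x : P // x ≠ 1} :=
    { toFun := fun e => e.toEquiv.subtypeEquiv fun x => by simp
      map_one' := rfl
      map_mul' := fun _ _ => rfl }
  have hf : Function.Injective f := by
    intro e e' h
    ext x
    by_cases hx : x = 1
    · rw [hx, map_one, map_one]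
    · exact congrArg Subtype.val (DFunLike.congr_fun h ⟨x, hx⟩)
  have h1 := Subgroup.card_dvd_of_injective f hf
  rwa [Nat.card_perm, Nat.card_eq_fintype_card (α := {x : P // x ≠ 1}),
    Fintype.card_subtype_compl, Fintype.card_subtype_eq, ← Nat.card_eq_fintype_card, hP] at h1

/-- P has exponent 2, hence is abelian of order 4. Thus |N : C| divides both 6 and the odd m,
leaving 1 or 3. The value 1 would prevent fusion inside P, contradicting that its involutions are
conjugate. -/
lemma card_normalizer_sylow_two {m : ℕ} (hm : Odd m) (hG : Nat.card G = 4 * m)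
    (h : HasConjInvolutions G) (P : Sylow 2 G) :
    Nat.card P = 4 ∧ (P : Subgroup G) ≤ Subgroup.centralizer ((P : Subgroup G) : Set G) ∧
    Nat.card (Subgroup.normalizer ((P : Subgroup G) : Set G)) =
      3 * Nat.card (Subgroup.centralizer ((P : Subgroup G) : Set G)) := by
  have hm0 : m ≠ 0 := by rintro rfl; simp at hm
  have hP : Nat.card P = 4 := by
    rw [P.card_eq_multiplicity, hG, show 4 = 2 ^ 2 by rfl,
      Nat.factorization_mul (by norm_num) hm0, Nat.prime_two.factorization_pow]
    simp [Nat.factorization_eq_zero_of_not_dvd hm.not_two_dvd_nat]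
  have hpp : ∀ y ∈ P, pPart 2 y = y := fun y hy =>
    pPart_eq_of_mem_isPGroup Nat.prime_two P.isPGroup' hy
  have hPC : (P : Subgroup G) ≤ Subgroup.centralizer ((P : Subgroup G) : Set G) := by
    intro y hy z hz
    have hinv : ∀ x ∈ P, x⁻¹ = x := fun x hx =>
      inv_eq_of_mul_eq_one_left (by rw [← sq]; exact h.pow_two (hpp x hx))
    have h1 := hinv _ ((P : Subgroup G).mul_mem hz hy)
    rw [mul_inv_rev, hinv y hy, hinv z hz] at h1
    exact h1.symm
  refine ⟨hP, hPC, ?_⟩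
  have hmul := card_normalizerMonoidHom_range_mul (P : Subgroup G)
  rw [← hmul]
  congr 1
  have h6 : Nat.card (P : Subgroup G).normalizerMonoidHom.range ∣ 6 :=
    (Subgroup.card_subgroup_dvd_card _).trans (card_mulAut_dvd_six hP)
  have hodd : Nat.card (P : Subgroup G).normalizerMonoidHom.range ∣ m := by
    have h4 : 4 ∣ Nat.card (Subgroup.centralizer ((P : Subgroup G) : Set G)) :=
      hP ▸ Subgroup.card_dvd_of_le hPC
    have h5 := (Nat.mul_dvd_mul_left
      (Nat.card (P : Subgroup G).normalizerMonoidHom.range) h4).trans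
      (hmul ▸ Subgroup.card_subgroup_dvd_card _)
    rw [hG, mul_comm] at h5
    exact Nat.dvd_of_mul_dvd_mul_left (by norm_num) h5
  have hne1 : Nat.card (P : Subgroup G).normalizerMonoidHom.range ≠ 1 := by
    intro h1
    rw [h1, one_mul] at hmul
    have hNC := normalizer_le_centralizer_of_card_le hmul.ge
    have : Nontrivial {x : P // x ≠ 1} := by
      classical
      have := Fintype.ofFinite P
      rw [← Fintype.one_lt_card_iff_nontrivial, Fintype.card_subtype_compl,
        Fintype.card_subtype_eq, ← Nat.card_eq_fintype_card]
      have : Nat.card ↥P = 4 := hP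
      omega
    obtain ⟨⟨⟨y, hy⟩, hy1⟩, ⟨⟨z, hz⟩, hz1⟩, hyz⟩ := exists_pair_ne {x : P // x ≠ 1}
    refine hyz (Subtype.ext (Subtype.ext (eq_of_isConj_of_mem_sylow P hNC hy hz ?_)))
    exact (h y z (hpp y hy) (hpp z hz) (fun h => hy1 (Subtype.ext h))
      (fun h => hz1 (Subtype.ext h))).2
  have hodd' := Odd.of_dvd_nat hm hodd
  have hle := Nat.le_of_dvd (by norm_num) h6
  generalize Nat.card (P : Subgroup G).normalizerMonoidHom.range = n at *
  interval_cases n <;> first | rfl | omega | (exfalso; revert hodd'; decide)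

end KleinSylow

/-! ### The case a = 1: recognizing the alternating group -/

section Alternating

variable {G : Type*} [Group G] [Finite G]

/-- If R were normal, C(R) would be a normal subgroup of order 2m. Having even order it would
contain a Sylow 2-subgroup, but 4 does not divide 2m. -/
lemma HasConjInvolutions.not_normal_of_card_normalizer {m p : ℕ} (h : HasConjInvolutions G)
    (hm : Odd m) (hG : Nat.card G = 4 * m) (R : Sylow p G)
    (hR : Nat.card (Subgroup.normalizer ((R : Subgroup G) : Set G)) =
      2 * Nat.card (Subgroup.centralizer ((R : Subgroup G) : Set G))) :
    ¬ (R : Subgroup G).Normal := by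
  intro hn
  have hC : Nat.card (Subgroup.centralizer ((R : Subgroup G) : Set G)) = 2 * m := by
    have := Subgroup.normalizer_eq_top_iff.2 hn
    rw [this, Subgroup.card_top, hG] at hR
    omega
  obtain ⟨P⟩ : Nonempty (Sylow 2 G) := inferInstance
  have hle : (P : Subgroup G) ≤ Subgroup.centralizer ((R : Subgroup G) : Set G) :=
    h.le_of_normal inferInstance (hC ▸ dvd_mul_right 2 m) P.isPGroup'
  have hd := Subgroup.card_dvd_of_le hle
  rw [hC, (card_normalizer_sylow_two hm hG h P).1] at hd
  obtain ⟨k, rfl⟩ := hm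
  omega

lemma card_sylow_mul_of_card_normalizer {p : ℕ} [Fact p.Prime]
    (hp1 : (Nat.card G).factorization p = 1) (R : Sylow p G)
    (hR : Nat.card (Subgroup.normalizer ((R : Subgroup G) : Set G)) =
      2 * Nat.card (Subgroup.centralizer ((R : Subgroup G) : Set G))) :
    ∃ c, Nat.card (Subgroup.centralizer ((R : Subgroup G) : Set G)) = p * c ∧
      Nat.card (Sylow p G) * (2 * (p * c)) = Nat.card G := by
  have hp := card_sylow_of_factorization_eq_one hp1 R
  have : IsCyclic R := isCyclic_of_prime_card hp
  have hle : (R : Subgroup G) ≤ Subgroup.centralizer ((R : Subgroup G) : Set G) :=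
    Subgroup.le_centralizer _
  obtain ⟨c, hc⟩ := Subgroup.card_dvd_of_le hle
  rw [hp] at hc
  refine ⟨c, hc, ?_⟩
  have h3 : Nat.card (Sylow p G) = (Subgroup.normalizer ((R : Subgroup G) : Set G)).index :=
    R.card_eq_index_normalizer
  rw [h3, ← hc, ← hR, mul_comm, Subgroup.card_mul_index]

omit [Finite G] in
lemma normal_of_card_sylow_eq_one {p : ℕ} [Fact p.Prime] (h : Nat.card (Sylow p G) = 1)
    (R : Sylow p G) : (R : Subgroup G).Normal := by
  have := (Nat.card_eq_one_iff_unique.1 h).1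
  exact R.normal_of_subsingleton

/-- The number of Sylow r-subgroups divides 6, is not 1, and is 1 modulo r, so r ≤ 5. -/
lemma HasConjInvolutions.eq_five {r : ℕ} (h : HasConjInvolutions G) [hr : Fact r.Prime]
    (hr5 : 5 ≤ r) (hG : Nat.card G = 4 * (3 * r)) (hr1 : (Nat.card G).factorization r = 1)
    (hR : ∀ R : Sylow r G, Nat.card (Subgroup.normalizer ((R : Subgroup G) : Set G)) =
      2 * Nat.card (Subgroup.centralizer ((R : Subgroup G) : Set G))) : r = 5 := by
  obtain ⟨R⟩ : Nonempty (Sylow r G) := inferInstance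
  obtain ⟨c, -, hc⟩ := card_sylow_mul_of_card_normalizer hr1 R (hR R)
  have hmod := card_sylow_modEq_one r G
  have hne1 : Nat.card (Sylow r G) ≠ 1 := fun h1 =>
    h.not_normal_of_card_normalizer ((by decide : Odd 3).mul (hr.out.odd_of_ne_two (by omega)))
      hG R (hR R) (normal_of_card_sylow_eq_one h1 R)
  have h6 : Nat.card (Sylow r G) * c = 6 := by
    have : (2 * r) * (Nat.card (Sylow r G) * c) = (2 * r) * 6 := by rw [hG] at hc; linarith
    exact Nat.eq_of_mul_eq_mul_left (by omega) this
  have hle : Nat.card (Sylow r G) ≤ 6 := Nat.le_of_dvd (by norm_num) ⟨c, h6.symm⟩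
  have hpos : 0 < Nat.card (Sylow r G) := Nat.card_pos
  have hd := (Nat.modEq_iff_dvd' (show 1 ≤ Nat.card (Sylow r G) by omega)).1 hmod.symm
  have := Nat.le_of_dvd (by omega) hd
  omega

/-- With |C| = 3c the Sylow number is 10/c; being 1 modulo 3 and not 1, it is 10. The analogue for 5
has 6 in place of 10. -/
lemma card_centralizer_three_of_card_sixty (h : HasConjInvolutions G) (hG : Nat.card G = 60)
    [Fact (Nat.Prime 3)] (h1 : (Nat.card G).factorization 3 = 1) (Q : Sylow 3 G)
    (hQ : Nat.card (Subgroup.normalizer ((Q : Subgroup G) : Set G)) =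
      2 * Nat.card (Subgroup.centralizer ((Q : Subgroup G) : Set G))) :
    Nat.card (Subgroup.centralizer ((Q : Subgroup G) : Set G)) = 3 := by
  obtain ⟨c, hC, hc⟩ := card_sylow_mul_of_card_normalizer h1 Q hQ
  have hmod := card_sylow_modEq_one 3 G
  have hne1 : Nat.card (Sylow 3 G) ≠ 1 := fun h1 =>
    h.not_normal_of_card_normalizer (m := 15) (by decide) hG Q hQ
      (normal_of_card_sylow_eq_one h1 Q)
  have hle : Nat.card (Sylow 3 G) ≤ 10 := Nat.le_of_dvd (by norm_num) ⟨c, by rw [hG] at hc; linarith⟩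
  rw [hG] at hc
  generalize Nat.card (Sylow 3 G) = n at *
  unfold Nat.ModEq at hmod
  interval_cases n <;> omega

lemma card_centralizer_five_of_card_sixty (h : HasConjInvolutions G) (hG : Nat.card G = 60)
    [Fact (Nat.Prime 5)] (h1 : (Nat.card G).factorization 5 = 1) (Q : Sylow 5 G)
    (hQ : Nat.card (Subgroup.normalizer ((Q : Subgroup G) : Set G)) =
      2 * Nat.card (Subgroup.centralizer ((Q : Subgroup G) : Set G))) :
    Nat.card (Subgroup.centralizer ((Q : Subgroup G) : Set G)) = 5 := by
  obtain ⟨c, hC, hc⟩ := card_sylow_mul_of_card_normalizer h1 Q hQ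
  have hmod := card_sylow_modEq_one 5 G
  have hne1 : Nat.card (Sylow 5 G) ≠ 1 := fun h1 =>
    h.not_normal_of_card_normalizer (m := 15) (by decide) hG Q hQ
      (normal_of_card_sylow_eq_one h1 Q)
  have hle : Nat.card (Sylow 5 G) ≤ 6 := Nat.le_of_dvd (by norm_num) ⟨c, by rw [hG] at hc; linarith⟩
  rw [hG] at hc
  generalize Nat.card (Sylow 5 G) = n at *
  unfold Nat.ModEq at hmod
  interval_cases n <;> omega

/-- An element of order p centralizing P would have P, of order 4, inside its centralizer of odd
order p. -/
lemma not_dvd_card_centralizer_sylow {p : ℕ} [hp : Fact p.Prime] (hp2 : p ≠ 2)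
    (hp1 : (Nat.card G).factorization p = 1)
    (hC : ∀ Q : Sylow p G, Nat.card (Subgroup.centralizer ((Q : Subgroup G) : Set G)) = p)
    {P : Subgroup G} (hP : Nat.card P = 4) :
    ¬ p ∣ Nat.card (Subgroup.centralizer (P : Set G)) := by
  intro hd
  obtain ⟨⟨y, hyC⟩, hy⟩ := exists_prime_orderOf_dvd_card' p hd
  rw [Subgroup.orderOf_mk] at hy
  have hyp : y ^ p ^ 1 = 1 := by rw [pow_one, ← hy, pow_orderOf_eq_one]
  obtain ⟨Q⟩ : Nonempty (Sylow p G) := inferInstance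
  obtain ⟨z, hz, hyz⟩ := exists_isConj_mem_sylow Q hyp
  have hz1 : z ≠ 1 := by
    rintro rfl
    rw [isConj_one_left] at hyz
    rw [hyz, orderOf_one] at hy
    exact hp.out.one_lt.ne hy
  have hCy : Nat.card (Subgroup.centralizer ({y} : Set G)) = p := by
    rw [card_centralizer_of_isConj hyz, centralizer_singleton_eq_of_card_eq_prime hp.out
      (card_sylow_of_factorization_eq_one hp1 Q) hz hz1, hC Q]
  have hle : P ≤ Subgroup.centralizer ({y} : Set G) := fun x hx =>
    Subgroup.mem_centralizer_singleton_iff.2 (hyC x hx)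
  have h4 := Subgroup.card_dvd_of_le hle
  rw [hP, hCy] at h4
  exact hp2 ((Nat.prime_dvd_prime_iff_eq Nat.prime_two hp.out).1
    ((by norm_num : 2 ∣ 4).trans h4)).symm

omit [Finite G] in
/-- A faithful action of a group of order sixty on five points identifies it with the alternating
group. -/
lemma nonempty_mulEquiv_alternatingGroup_of_injective (hG : Nat.card G = 60) {X : Type*}
    [Finite X] (hX : Nat.card X = 5) (f : G →* Equiv.Perm X) (hf : Function.Injective f) :
    Nonempty (G ≃* alternatingGroup (Fin 5)) := by
  classical
  have := Fintype.ofFinite X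
  have hidx : f.range.index = 2 := by
    have h1 := f.range.card_mul_index
    rw [← Nat.card_congr (MonoidHom.ofInjective hf).toEquiv, hG, Nat.card_perm, hX,
      show Nat.factorial 5 = 120 by rfl] at h1
    omega
  have e : X ≃ Fin 5 := Fintype.equivFinOfCardEq (by rw [← Nat.card_eq_fintype_card, hX])
  exact ⟨(MonoidHom.ofInjective hf).trans ((MulEquiv.subgroupCongr
    (Equiv.Perm.eq_alternatingGroup_of_index_eq_two hidx)).trans (Equiv.altCongrHom e))⟩

theorem nonempty_mulEquiv_alternatingGroup (h : HasConjInvolutions G) (hG : Nat.card G = 60)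
    [Fact (Nat.Prime 3)] [Fact (Nat.Prime 5)] (h3 : (Nat.card G).factorization 3 = 1)
    (h5 : (Nat.card G).factorization 5 = 1)
    (hQ : ∀ Q : Sylow 3 G, Nat.card (Subgroup.normalizer ((Q : Subgroup G) : Set G)) =
      2 * Nat.card (Subgroup.centralizer ((Q : Subgroup G) : Set G)))
    (hR : ∀ R : Sylow 5 G, Nat.card (Subgroup.normalizer ((R : Subgroup G) : Set G)) =
      2 * Nat.card (Subgroup.centralizer ((R : Subgroup G) : Set G))) :
    Nonempty (G ≃* alternatingGroup (Fin 5)) := by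
  -- |C(P)| is a multiple of 4 dividing 20 and prime to 5, so it is 4 and |N(P)| = 12. This gives
  -- five Sylow 2-subgroups.
  have hN : ∀ P : Sylow 2 G,
      Nat.card (Subgroup.normalizer ((P : Subgroup G) : Set G)) = 12 := by
    intro P
    obtain ⟨hP, hPC, hN⟩ := card_normalizer_sylow_two (m := 15) (by decide) hG h P
    have hC3 := not_dvd_card_centralizer_sylow (by norm_num) h3
      (fun Q => card_centralizer_three_of_card_sixty h hG h3 Q (hQ Q)) hP
    have hC5 := not_dvd_card_centralizer_sylow (by norm_num) h5
      (fun Q => card_centralizer_five_of_card_sixty h hG h5 Q (hR Q)) hP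
    have hd := Subgroup.card_subgroup_dvd_card
      (Subgroup.normalizer ((P : Subgroup G) : Set G))
    have h4 := Subgroup.card_dvd_of_le hPC
    rw [hP] at h4
    rw [hN, hG, show 60 = 3 * 20 by rfl] at hd
    have hd' := Nat.dvd_of_mul_dvd_mul_left (by norm_num) hd
    have hle := Nat.le_of_dvd (by norm_num) hd'
    rw [hN]
    obtain ⟨k, hk⟩ := h4
    rw [hk] at hC3 hC5 hd' hle ⊢
    have : k ≤ 5 := by omega
    interval_cases k <;> omega
  obtain ⟨P⟩ : Nonempty (Sylow 2 G) := inferInstance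
  have hcard : Nat.card (Sylow 2 G) = 5 := by
    have h1 : Nat.card (Sylow 2 G) = (Subgroup.normalizer ((P : Subgroup G) : Set G)).index :=
      P.card_eq_index_normalizer
    have h2 := (Subgroup.normalizer ((P : Subgroup G) : Set G)).card_mul_index
    rw [hN, hG, ← h1] at h2
    omega
  refine nonempty_mulEquiv_alternatingGroup_of_injective hG hcard
    (MulAction.toPermHom G (Sylow 2 G)) ?_
  set f := MulAction.toPermHom G (Sylow 2 G)
  have hker : ∀ g ∈ f.ker, ∀ P : Sylow 2 G, g • P = P := fun g hg P =>
    DFunLike.congr_fun (MonoidHom.mem_ker.1 hg) P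
  have hKN : f.ker ≤ Subgroup.normalizer ((P : Subgroup G) : Set G) := fun g hg =>
    Sylow.smul_eq_iff_mem_normalizer.1 (hker g hg P)
  have hK12 := Subgroup.card_dvd_of_le hKN
  rw [hN] at hK12
  -- A kernel of even order would contain P, so P would fix every Sylow 2-subgroup and be the only
  -- one.
  have hK2 : ¬ 2 ∣ Nat.card f.ker := by
    intro h2
    have hle := h.le_of_normal (MonoidHom.normal_ker f) h2 P.isPGroup'
    have : Subsingleton (Sylow 2 G) := by
      refine ⟨fun Q Q' => ?_⟩
      have hall : ∀ Q : Sylow 2 G, P = Q := fun Q => by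
        have h1 : Q ∈ MulAction.fixedPoints (P : Subgroup G) (Sylow 2 G) :=
          fun g => hker g.1 (hle g.2) Q
        have h2 := P.isPGroup'.sylow_mem_fixedPoints_iff.1 h1
        exact Sylow.ext (P.is_maximal' Q.isPGroup' h2).symm
      rw [← hall Q, ← hall Q']
    rw [Nat.card_of_subsingleton P] at hcard
    omega
  -- An odd order dividing 12 and divisible by 3 is 3, so the kernel would be a normal Sylow
  -- 3-subgroup.
  have hK3 : ¬ 3 ∣ Nat.card f.ker := by
    intro hd
    obtain ⟨Q⟩ : Nonempty (Sylow 3 G) := inferInstance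
    have hQ3 := card_sylow_of_factorization_eq_one h3 Q
    have hle := Nat.le_of_dvd (by norm_num) hK12
    have hKc : Nat.card f.ker = 3 := by
      generalize Nat.card f.ker = n at *
      interval_cases n <;> omega
    have hKQ : f.ker = (Q : Subgroup G) := by
      have : IsPGroup 3 f.ker := IsPGroup.of_card (n := 1) (by rw [hKc, pow_one])
      have hle := this.le_sylow_of_normal Q
      exact Subgroup.eq_of_le_of_card_ge hle (by rw [hKc, hQ3])
    refine h.not_normal_of_card_normalizer (m := 15) (by decide) hG Q (hQ Q) ?_
    rw [← hKQ]
    infer_instance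
  rw [← MonoidHom.ker_eq_bot_iff, Subgroup.eq_bot_iff_card]
  have hle := Nat.le_of_dvd (by norm_num) hK12
  generalize Nat.card f.ker = n at *
  interval_cases n <;> omega

end Alternating

lemma factorization_eq_one_of_eq_two_pow_mul {a q r n : ℕ} (hq : q.Prime) (hr : r.Prime) (hq2 : q ≠ 2)
    (hqr : q ≠ r) (hG : n = 2 ^ (a + 1) * (q * r)) :
    n.factorization q = 1 := by
  rw [hG, Nat.factorization_mul (by positivity) (mul_ne_zero hq.ne_zero hr.ne_zero),
    Nat.factorization_mul hq.ne_zero hr.ne_zero, Nat.prime_two.factorization_pow,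
    hq.factorization, hr.factorization]
  simp [hqr.symm, hq2.symm]

/-! ### Classification of the groups with the given exponents -/

section Converse

variable {G : Type*} [Group G] [Finite G] {q r : ℕ}

lemma hasConjInvolutions_of_factorization_rho {a : ℕ} (hq2 : Odd q) (hr2 : Odd r)
    (hG : Nat.card G = 2 ^ (a + 1) * (q * r)) (h2 : (rho G).factorization 2 = q * r) :
    HasConjInvolutions G := by
  have hodd := hq2.mul hr2
  have hne : q * r ≠ 0 := by intro h; rw [h] at hodd; simp at hodd
  have hf : (Nat.card G).factorization 2 = a + 1 := by
    rw [hG, Nat.factorization_mul (by positivity) hne, Nat.prime_two.factorization_pow]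
    simp [Nat.factorization_eq_zero_of_not_dvd hodd.not_two_dvd_nat]
  intro y z hy hz hy1 hz1
  refine isConj_of_factorization_rho_eq Nat.prime_two ?_ hy hz hy1 hz1
  rw [h2, hf, hG, Nat.mul_div_cancel_left _ (by positivity)]

lemma card_normalizer_eq_of_factorization_rho {a : ℕ} (hq : q.Prime) (hr : r.Prime) (hq2 : q ≠ 2)
    (hqr : q ≠ r) (hG : Nat.card G = 2 ^ (a + 1) * (q * r))
    (h : (rho G).factorization q = 2 * r * (q - 1)) (Q : Sylow q G) :
    Nat.card (Subgroup.normalizer ((Q : Subgroup G) : Set G)) =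
      2 ^ a * Nat.card (Subgroup.centralizer ((Q : Subgroup G) : Set G)) := by
  have := Fact.mk hq
  have key := factorization_rho_mul_card_normalizer
    (factorization_eq_one_of_eq_two_pow_mul hq hr hq2 hqr hG) Q
  rw [h, hG] at key
  have hpos : 0 < 2 * r * (q - 1) * q := by
    have := hq.one_lt
    have := hr.pos
    have : 0 < q - 1 := by omega
    positivity
  refine Nat.eq_of_mul_eq_mul_left hpos ?_
  rw [pow_succ] at key
  linarith

lemma nonempty_mulEquiv_of_three (hr : r.Prime) (hr2 : r ≠ 2) (hr3 : 3 ≠ r)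
    (hG : Nat.card G = 2 ^ (1 + 1) * (3 * r)) (h2 : (rho G).factorization 2 = 3 * r)
    (h3 : (rho G).factorization 3 = 2 * r * (3 - 1))
    (hrr : (rho G).factorization r = 2 * 3 * (r - 1)) :
    r = 5 ∧ Nonempty (G ≃* alternatingGroup (Fin 5)) := by
  have hinv := hasConjInvolutions_of_factorization_rho (by decide) (hr.odd_of_ne_two hr2) hG h2
  have := Fact.mk hr
  have hG' : Nat.card G = 2 ^ (1 + 1) * (r * 3) := by rw [hG, mul_comm 3]
  have hR := card_normalizer_eq_of_factorization_rho hr Nat.prime_three hr2 hr3.symm hG' hrr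
  have hQ := card_normalizer_eq_of_factorization_rho Nat.prime_three hr (by norm_num) hr3 hG h3
  have hr1 := factorization_eq_one_of_eq_two_pow_mul hr Nat.prime_three hr2 hr3.symm hG'
  have hq1 := factorization_eq_one_of_eq_two_pow_mul Nat.prime_three hr (by norm_num) hr3 hG
  have hr5 : 5 ≤ r := by
    have := hr.two_le
    by_contra hlt
    have : r = 4 := by omega
    subst this
    revert hr
    decide
  obtain rfl := hinv.eq_five hr5 hG hr1 hR
  exact ⟨rfl, nonempty_mulEquiv_alternatingGroup hinv hG hq1 hr1 hQ hR⟩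

theorem nonempty_mulEquiv_of_expRho_eq (hq : q.Prime) (hr : r.Prime) (hq2 : q ≠ 2) (hr2 : r ≠ 2)
    (hqr : q ≠ r) (h : expRho G = {q * r, 2 * r * (q - 1), 2 * q * (r - 1)}) :
    Nonempty (G ≃* Multiplicative (ZMod (2 * q * r))) ∨
      (({q, r} : Set ℕ) = {3, 5} ∧ Nonempty (G ≃* alternatingGroup (Fin 5))) := by
  obtain ⟨⟨a, hG⟩, h2, hQ, hR⟩ := exists_card_eq_of_expRho_eq hq hr hq2 hr2 hqr h
  have hinv := hasConjInvolutions_of_factorization_rho (hq.odd_of_ne_two hq2)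
    (hr.odd_of_ne_two hr2) hG h2
  have hG' : Nat.card G = 2 ^ (a + 1) * (r * q) := by rw [hG, mul_comm q]
  have hNQ := card_normalizer_eq_of_factorization_rho hq hr hq2 hqr hG hQ
  have hNR := card_normalizer_eq_of_factorization_rho hr hq hr2 hqr.symm hG' hR
  have ha : a ≤ 1 := by
    have := Fact.mk hq
    obtain ⟨Q⟩ : Nonempty (Sylow q G) := inferInstance
    refine le_one_of_card_normalizerMonoidHom_range_eq hq (P := Q)
      (card_sylow_of_factorization_eq_one (factorization_eq_one_of_eq_two_pow_mul hq hr hq2 hqr hG) Q) ?_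
      fun g => hinv.pow_two (pPart_pPart Nat.prime_two g)
    have h1 := card_normalizerMonoidHom_range_mul (Q : Subgroup G)
    rw [hNQ Q] at h1
    exact Nat.eq_of_mul_eq_mul_right Nat.card_pos h1
  obtain rfl | rfl : a = 0 ∨ a = 1 := by omega
  · left
    refine nonempty_mulEquiv_zmod_of_normalizer_le hq hr hq2 hr2 hqr (by rw [hG]; ring) ?_
    rintro p (rfl | rfl) P
    · exact normalizer_le_centralizer_of_card_le (by rw [hNQ P, pow_zero, one_mul])
    · exact normalizer_le_centralizer_of_card_le (by rw [hNR P, pow_zero, one_mul])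
  · right
    -- Fusion in a Sylow 2-subgroup gives |N : C| = 3, so 3 divides |G| = 4qr.
    have h3 : 3 ∣ q * r := by
      obtain ⟨P⟩ : Nonempty (Sylow 2 G) := inferInstance
      obtain ⟨-, -, hN⟩ := card_normalizer_sylow_two
        ((hq.odd_of_ne_two hq2).mul (hr.odd_of_ne_two hr2)) hG hinv P
      have h3G : 3 ∣ Nat.card G := (Dvd.intro _ hN.symm).trans (Subgroup.card_subgroup_dvd_card _)
      rw [hG] at h3G
      exact (Nat.Coprime.pow_right 2 (by norm_num)).dvd_of_dvd_mul_left h3G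
    rw [Nat.prime_three.dvd_mul, Nat.prime_dvd_prime_iff_eq Nat.prime_three hq,
      Nat.prime_dvd_prime_iff_eq Nat.prime_three hr] at h3
    rcases h3 with rfl | rfl
    · obtain ⟨rfl, he⟩ := nonempty_mulEquiv_of_three hr hr2 hqr hG h2 hQ hR
      exact ⟨rfl, he⟩
    · obtain ⟨rfl, he⟩ := nonempty_mulEquiv_of_three hq hq2 hqr.symm hG' (by rw [h2, mul_comm])
        hR hQ
      exact ⟨Set.pair_comm _ _, he⟩

end Converse

/-! ### Exponents of the cyclic group -/

section Abelian

lemma factorization_rho_of_comm {G : Type*} [CommGroup G] [Finite G] {p m : ℕ} (hp : p.Prime)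
    (hm : ¬ p ∣ m) (hG : Nat.card G = p * m) : (rho G).factorization p = m * (p - 1) := by
  have := Fact.mk hp
  have hm0 : m ≠ 0 := by rintro rfl; exact hm (dvd_zero p)
  obtain ⟨P⟩ : Nonempty (Sylow p G) := inferInstance
  have key := factorization_rho_mul_card_normalizer (G := G) (p := p) (by
    rw [hG, Nat.factorization_mul hp.ne_zero hm0, Finsupp.add_apply, hp.factorization_self,
      Nat.factorization_eq_zero_of_not_dvd hm]) P
  have hC : Subgroup.centralizer ((P : Subgroup G) : Set G) = ⊤ :=
    top_le_iff.1 fun x _ y _ => mul_comm y x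
  rw [Subgroup.normalizer_eq_top, hC, Subgroup.card_top, hG] at key
  have hpos : 0 < p * (p * m) := by have := hp.pos; positivity
  refine Nat.eq_of_mul_eq_mul_right hpos ?_
  linarith

theorem expRho_zmod {q r : ℕ} (hq : q.Prime) (hr : r.Prime) (hq2 : q ≠ 2) (hr2 : r ≠ 2)
    (hqr : q ≠ r) : expRho (Multiplicative (ZMod (2 * q * r))) =
      {q * r, 2 * r * (q - 1), 2 * q * (r - 1)} := by
  have : NeZero (2 * q * r) :=
    ⟨mul_ne_zero (mul_ne_zero two_ne_zero hq.ne_zero) hr.ne_zero⟩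
  have hcard : Nat.card (Multiplicative (ZMod (2 * q * r))) = 2 * q * r := by simp
  have hnd : ∀ {a b c : ℕ}, a.Prime → b.Prime → c.Prime → a ≠ b → a ≠ c → ¬ a ∣ b * c := by
    intro a b c ha hb hc hab hac h
    rw [ha.dvd_mul, Nat.prime_dvd_prime_iff_eq ha hb, Nat.prime_dvd_prime_iff_eq ha hc] at h
    tauto
  have e2 := factorization_rho_of_comm (G := Multiplicative (ZMod (2 * q * r))) Nat.prime_two
    (hnd Nat.prime_two hq hr hq2.symm hr2.symm) (by rw [hcard, mul_assoc])
  have eq := factorization_rho_of_comm (G := Multiplicative (ZMod (2 * q * r))) hq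
    (hnd hq Nat.prime_two hr hq2 hqr) (by rw [hcard]; ring)
  have er := factorization_rho_of_comm (G := Multiplicative (ZMod (2 * q * r))) hr
    (hnd hr Nat.prime_two hq hr2 hqr.symm) (by rw [hcard]; ring)
  ext n
  simp only [mem_expRho, hcard, Finset.mem_insert, Finset.mem_singleton]
  constructor
  · rintro ⟨p, hp, hd, rfl⟩
    rw [hp.dvd_mul, hp.dvd_mul, Nat.prime_dvd_prime_iff_eq hp hq,
      Nat.prime_dvd_prime_iff_eq hp hr, Nat.prime_dvd_prime_iff_eq hp Nat.prime_two] at hd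
    rcases hd with (rfl | rfl) | rfl
    · left; rw [e2]; simp
    · exact .inr (.inl eq)
    · exact .inr (.inr er)
  · rintro (rfl | rfl | rfl)
    · exact ⟨2, Nat.prime_two, ⟨q * r, by ring⟩, by rw [e2]; simp⟩
    · exact ⟨q, hq, ⟨2 * r, by ring⟩, eq⟩
    · exact ⟨r, hr, ⟨2 * q, by ring⟩, er⟩

end Abelian

/-! ### Element orders in PSL(2,5) -/

section PSL

open Matrix

/-- The order in `PSL(2, 5)` of the class of a matrix with the given entries. -/
def projOrder (x : ZMod 5 × ZMod 5 × ZMod 5 × ZMod 5) : ℕ :=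
  if x.2.1 = 0 ∧ x.2.2.1 = 0 ∧ x.1 = x.2.2.2 then 1
  else if x.1 + x.2.2.2 = 0 then 2
  else if (x.1 + x.2.2.2) ^ 2 = 1 then 3 else 5

lemma mem_center_SL_two_iff {R : Type*} [CommRing R] (A : SpecialLinearGroup (Fin 2) R) :
    A ∈ Subgroup.center (SpecialLinearGroup (Fin 2) R) ↔
      A 0 1 = 0 ∧ A 1 0 = 0 ∧ A 0 0 = A 1 1 := by
  rw [Matrix.SpecialLinearGroup.mem_center_iff]
  constructor
  · rintro ⟨r, -, hr⟩
    rw [← hr]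
    simp
  · rintro ⟨h1, h2, h3⟩
    refine ⟨A 0 0, ?_, ?_⟩
    · have := A.det_coe
      rw [det_fin_two, h1, zero_mul, sub_zero, ← h3] at this
      rw [Fintype.card_fin, sq, this]
    · ext i j
      fin_cases i <;> fin_cases j <;> simp [h1, h2, h3]

/-- For determinant 1 and trace t, Cayley–Hamilton gives A² = tA − 1 and A³ = (t² − 1)A − t, so t =
0 makes A² scalar and t² = 1 makes A³ scalar. Otherwise t = ±2 and ±A is unipotent, with fifth power
1. As 2, 3, 5 are prime, this gives exact orders for nonscalar A. -/
lemma pow_projOrder : ∀ a b c d : ZMod 5, a * d - b * c = 1 →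
    (!![a, b; c, d] ^ projOrder (a, b, c, d)) 0 1 = 0 ∧
    (!![a, b; c, d] ^ projOrder (a, b, c, d)) 1 0 = 0 ∧
    (!![a, b; c, d] ^ projOrder (a, b, c, d)) 0 0 =
      (!![a, b; c, d] ^ projOrder (a, b, c, d)) 1 1 := by
  decide +kernel

lemma orderOf_mk_PSL_two_five (A : SpecialLinearGroup (Fin 2) (ZMod 5)) :
    orderOf (A : ProjectiveSpecialLinearGroup (Fin 2) (ZMod 5)) =
      projOrder (A 0 0, A 0 1, A 1 0, A 1 1) := by
  have hdet : A 0 0 * A 1 1 - A 0 1 * A 1 0 = 1 := by rw [← det_fin_two]; exact A.det_coe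
  have hpow := pow_projOrder _ _ _ _ hdet
  rw [← eta_fin_two (A : Matrix (Fin 2) (Fin 2) (ZMod 5)), ← Matrix.SpecialLinearGroup.coe_pow, ← mem_center_SL_two_iff,
    ← QuotientGroup.eq_one_iff, QuotientGroup.mk_pow] at hpow
  have hone := mem_center_SL_two_iff A
  rw [← QuotientGroup.eq_one_iff] at hone
  generalize hn : projOrder (A 0 0, A 0 1, A 1 0, A 1 1) = n at hpow ⊢
  rw [projOrder] at hn
  split_ifs at hn with h1 h2 h3
  · rw [hone.2 h1, orderOf_one, hn]
  · subst hn
    have := Fact.mk Nat.prime_two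
    exact orderOf_eq_prime hpow fun h => h1 (hone.1 h)
  · subst hn
    have := Fact.mk Nat.prime_three
    exact orderOf_eq_prime hpow fun h => h1 (hone.1 h)
  · subst hn
    have := Fact.mk Nat.prime_five
    exact orderOf_eq_prime hpow fun h => h1 (hone.1 h)

lemma prod_projOrder : (∏ x : ZMod 5 × ZMod 5 × ZMod 5 × ZMod 5,
    if x.1 * x.2.2.2 - x.2.1 * x.2.2.1 = 1 then projOrder x else 1) =
      2 ^ 30 * 3 ^ 40 * 5 ^ 48 := by
  decide +kernel

lemma prod_orderOf_mk_PSL_two_five : ∏ A : SpecialLinearGroup (Fin 2) (ZMod 5),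
    orderOf (A : ProjectiveSpecialLinearGroup (Fin 2) (ZMod 5)) = 2 ^ 30 * 3 ^ 40 * 5 ^ 48 := by
  rw [← prod_projOrder, ← Finset.prod_filter]
  refine Finset.prod_bij (fun A _ => (A 0 0, A 0 1, A 1 0, A 1 1)) ?_ ?_ ?_ ?_
  · intro A _
    rw [Finset.mem_filter]
    exact ⟨Finset.mem_univ _, by rw [← det_fin_two]; exact A.det_coe⟩
  · intro A _ B _ h
    simp only [Prod.mk.injEq] at h
    ext i j
    fin_cases i <;> fin_cases j <;> simp [h]
  · rintro ⟨a, b, c, d⟩ h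
    exact ⟨⟨!![a, b; c, d], by rw [det_fin_two_of]; exact (Finset.mem_filter.1 h).2⟩,
      Finset.mem_univ _, rfl⟩
  · exact fun A _ => orderOf_mk_PSL_two_five A

lemma scalar_SL_two_five : ∀ a b c d : ZMod 5, a * d - b * c = 1 → b = 0 ∧ c = 0 ∧ a = d →
    !![a, b; c, d] = 1 ∨ !![a, b; c, d] = -1 := by
  decide +kernel

lemma card_center_SL_two_five :
    Nat.card (Subgroup.center (SpecialLinearGroup (Fin 2) (ZMod 5))) = 2 := by
  have h : (Subgroup.center (SpecialLinearGroup (Fin 2) (ZMod 5)) :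
      Set (SpecialLinearGroup (Fin 2) (ZMod 5))) = {1, -1} := by
    ext A
    rw [SetLike.mem_coe, mem_center_SL_two_iff]
    constructor
    · intro h
      have hdet : A 0 0 * A 1 1 - A 0 1 * A 1 0 = 1 := by rw [← det_fin_two]; exact A.det_coe
      have := scalar_SL_two_five _ _ _ _ hdet h
      rw [← eta_fin_two (A : Matrix (Fin 2) (Fin 2) (ZMod 5))] at this
      exact this.imp (fun h => Subtype.ext h) fun h => Subtype.ext h
    · rintro (rfl | rfl) <;> simp
  have hne : (1 : SpecialLinearGroup (Fin 2) (ZMod 5)) ≠ -1 := fun h => by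
    have h00 := congrArg (fun A : SpecialLinearGroup (Fin 2) (ZMod 5) => A 0 0) h
    revert h00
    simp
    decide
  have hc := Set.ncard_pair hne
  rw [← h] at hc
  exact hc

/-- Each element of PSL(2,5) has two lifts to SL(2,5), so the product over matrices is the square of
`rho`. -/
lemma rho_PSL_two_five : rho (ProjectiveSpecialLinearGroup (Fin 2) (ZMod 5)) =
    2 ^ 15 * 3 ^ 20 * 5 ^ 24 := by
  classical
  have := Fintype.ofFinite (ProjectiveSpecialLinearGroup (Fin 2) (ZMod 5))
  have hfib : ∀ g : ProjectiveSpecialLinearGroup (Fin 2) (ZMod 5),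
      (Finset.univ.filter fun A : SpecialLinearGroup (Fin 2) (ZMod 5) =>
        (A : ProjectiveSpecialLinearGroup (Fin 2) (ZMod 5)) = g).card = 2 := by
    intro g
    have h := QuotientGroup.card_preimage_mk
      (Subgroup.center (SpecialLinearGroup (Fin 2) (ZMod 5))) {g}
    rw [card_center_SL_two_five, Nat.card_unique (α := ({g} : Set _)), mul_one] at h
    rw [← Fintype.card_subtype, ← Nat.card_eq_fintype_card]
    exact h
  have h := prod_orderOf_mk_PSL_two_five
  rw [← Finset.prod_fiberwise _ fun A : SpecialLinearGroup (Fin 2) (ZMod 5) =>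
    (A : ProjectiveSpecialLinearGroup (Fin 2) (ZMod 5))] at h
  rw [Finset.prod_congr rfl fun g _ => (Finset.prod_congr rfl fun A hA =>
    congrArg orderOf (Finset.mem_filter.1 hA).2).trans (Finset.prod_const (orderOf g))] at h
  simp only [hfib] at h
  rw [Finset.prod_pow, ← finprod_eq_prod_of_fintype] at h
  refine Nat.pow_left_injective two_ne_zero ?_
  change rho _ ^ 2 = _ at h
  exact h.trans (by norm_num)

lemma expRho_PSL_two_five :
    expRho (ProjectiveSpecialLinearGroup (Fin 2) (ZMod 5)) = {15, 20, 24} := by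
  have h2 : (2 ^ 15 : ℕ) ≠ 0 := by norm_num
  have h3 : (3 ^ 20 : ℕ) ≠ 0 := by norm_num
  have h5 : (5 ^ 24 : ℕ) ≠ 0 := by norm_num
  rw [expRho, expSet, rho_PSL_two_five, Nat.primeFactors_mul (mul_ne_zero h2 h3) h5,
    Nat.primeFactors_mul h2 h3, Nat.primeFactors_prime_pow (by norm_num) Nat.prime_two,
    Nat.primeFactors_prime_pow (by norm_num) Nat.prime_three,
    Nat.primeFactors_prime_pow (by norm_num) Nat.prime_five,
    Nat.factorization_mul (mul_ne_zero h2 h3) h5, Nat.factorization_mul h2 h3,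
    Nat.prime_two.factorization_pow, Nat.prime_three.factorization_pow,
    Nat.prime_five.factorization_pow]
  simp

/-- The classification is applied to PSL(2,5) itself with q = 3, r = 5; the cyclic alternative fails
because no element has order 30. -/
lemma nonempty_PSL_two_five_mulEquiv_alternatingGroup :
    Nonempty (ProjectiveSpecialLinearGroup (Fin 2) (ZMod 5) ≃* alternatingGroup (Fin 5)) := by
  refine ((nonempty_mulEquiv_of_expRho_eq Nat.prime_three Nat.prime_five (by norm_num)
    (by norm_num) (by norm_num) expRho_PSL_two_five).resolve_left ?_).2
  rintro ⟨e⟩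
  obtain ⟨A, hA⟩ := QuotientGroup.mk_surjective (e.symm (Multiplicative.ofAdd 1))
  have h1 := orderOf_mk_PSL_two_five A
  rw [hA, e.symm.orderOf_eq, orderOf_ofAdd_eq_addOrderOf, ZMod.addOrderOf_one, projOrder] at h1
  split_ifs at h1 <;> omega

end PSL

theorem mainTheorem2 {G : Type*} [Group G] [Finite G] (q r : ℕ)
    (hq : q.Prime) (hr : r.Prime) (hq2 : Odd q) (hr2 : Odd r) (hqr : q ≠ r) :
    expRho (Multiplicative (ZMod (2 * q * r))) = {q * r, 2 * r * (q - 1), 2 * q * (r - 1)} ∧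
    (((({q, r} : Set ℕ) = {3, 5} ∧
          Nonempty (G ≃* Matrix.ProjectiveSpecialLinearGroup (Fin 2) (ZMod 5))) ∨
        Nonempty (G ≃* Multiplicative (ZMod (2 * q * r)))) ↔
      expRho G = expRho (Multiplicative (ZMod (2 * q * r)))) := by
  have hq2' : q ≠ 2 := by rintro rfl; revert hq2; decide
  have hr2' : r ≠ 2 := by rintro rfl; revert hr2; decide
  have hZ := expRho_zmod hq hr hq2' hr2' hqr
  refine ⟨hZ, ?_, fun h => ?_⟩
  · rintro (⟨hset, ⟨e⟩⟩ | ⟨⟨e⟩⟩)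
    · rw [hZ, expRho, rho_congr e, ← expRho, expRho_PSL_two_five]
      rcases Set.pair_eq_pair_iff.1 hset with ⟨rfl, rfl⟩ | ⟨rfl, rfl⟩ <;> decide
    · rw [expRho, rho_congr e, ← expRho]
  · rcases nonempty_mulEquiv_of_expRho_eq hq hr hq2' hr2' hqr (h.trans hZ) with h | ⟨hset, ⟨e⟩⟩
    · exact .inr h
    · obtain ⟨e'⟩ := nonempty_PSL_two_five_mulEquiv_alternatingGroup
      exact .inl ⟨hset, ⟨e.trans e'.symm⟩⟩
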